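/- **Setting.** Let $y=(n,\bar x_1,\bar x_2,s_1,s_2,r)$ with $n\ge 1$ an integer, $\bar x_1,\bar x_2\in\mathbb R$, $s_1,s_2>0$, $|r|<1$, be the summary of $n$ bivariate normal observations (sample means, root average sums of squares, sample correlation). For $\theta=(\mu_1,\mu_2,\sigma_1,\sigma_2,\rho)$ with $\mu_i\in\mathbb R$, $\sigma_i>0$, $|\rho|<1$ the likelihood is $$f(y\mid\theta)=\bigl(2\pi\sigma_1\sigma_2\sqrt{1-\rho^2}\bigr)^{-n}\exp\Bigl(-\tfrac{n}{2(1-\rho^2)}\Bigl[\tfrac{(\bar x_1-\mu_1)^2}{\sigma_1^2}-2\rho\tfrac{(\bar x_1-\mu_1)(\bar x_2-\mu_2)}{\sigma_1\sigma_2}+\tfrac{(\bar x_2-\mu_2)^2}{\sigma_2^2}+\tfrac{s_1^2}{\sigma_1^2}-2\rho\tfrac{r s_1s_2}{\sigma_1\sigma_2}+\tfrac{s_2^2}{\sigma_2^2}\Bigr]\Bigr).$$ For real $\alpha,\beta,\gamma,\delta$ and a constant $C>0$ the (possibly improper) prior is $\pi_\eta(\theta)=\pi_{\alpha,\beta}(\rho)\,\sigma_1^{\gamma-1}\sigma_2^{\delta-1}$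 with $\pi_{\alpha,\beta}(\rho)=\frac1C(1-\rho^2)^{\alpha-1}(1+\rho^2)^{\beta/2}$. Write $\mathcal B(u,v)=\Gamma(u)\Gamma(v)/\Gamma(u+v)$, $(x)_m=x(x+1)\cdots(x+m-1)$, and ${}_2F_1$ for Gauss' hypergeometric function (the sum of its series for $|z|<1$, continued analytically to real $z\le -1$). Put $$W=\frac{\Gamma(\frac{n-\gamma}2)\Gamma(\frac{n-\delta}2)}{\Gamma(\frac{n-\gamma-1}2)\Gamma(\frac{n-\delta-1}2)},\qquad A(\rho)=(1-\rho^2)^{\frac{n-\gamma-\delta-1}2}{}_2F_1\bigl(\tfrac{n-\gamma-1}2,\tfrac{n-\delta-1}2;\tfrac12;r^2\rho^2\bigr),$$ $$B(\rho)=2r\rho\,(1-\rho^2)^{\frac{n-\gamma-\delta-1}2}\,W\,{}_2F_1\bigl(\tfrac{n-\gamma}2,\tfrac{n-\delta}2;\tfrac32;r^2\rho^2\bigr),\qquad h=A+B,\qquad p(n,r)=\int_{-1}^1 h(\rho)\,\pi_{\alpha,\beta}(\rho)\,d\rho .$$ Let $p_{\gamma,\delta}(y_0)$ be the integral of $f(y\mid\theta)\sigma_1^{\gamma-1}\sigma_2^{\delta-1}$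 at $\rho=0$ over $(\mu_1,\mu_2,\sigma_1,\sigma_2)$, and $p_\eta(y)$ the integral of $f(y\mid\theta)\pi_\eta(\theta)$ over all of $\theta$. The posterior of $\theta$ has density $f(y\mid\theta)\pi_\eta(\theta)/p_\eta(y)$, and $E(\rho^k\mid n,r)$ is the $k$th moment of its $\rho$-marginal. **Corollary (Characterization of the marginal posteriors of $\rho$).** Assume $n>\gamma+1$, $n>\delta+1$ and $n>\gamma+\delta-2\alpha+1$. 1. If $\alpha>0$, then $C_{\alpha,\beta}=\mathcal B(\frac12,\alpha)\,{}_2F_1(-\frac\beta2,\frac12;\alpha+\frac12;-1)$ is positive, and $\pi_{\alpha,\beta}$ with $C=C_{\alpha,\beta}$ integrates to $1$ over $(-1,1)$. 2. The integrals defining $p_\eta(y)$ and $p_{\gamma,\delta}(y_0)$ converge, $p_\eta(y)=p_{\gamma,\delta}(y_0)\,p(n,r)$, and $$p_{\gamma,\delta}(y_0)=2^{\frac{-\gamma-\delta-4}2}\tfrac{\pi^{1-n}}n(ns_1^2)^{\frac{1+\gamma-n}2}(ns_2^2)^{\frac{1+\delta-n}2}\Gamma(\tfrac{n-\gamma-1}2)\Gamma(\tfrac{n-\delta-1}2).$$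 3. $A\pi_{\alpha,\beta}$ and $B\pi_{\alpha,\beta}$ are integrable on $(-1,1)$, $\int_{-1}^1B\pi_{\alpha,\beta}\,d\rho=0$, and $p(n,r)=\int_{-1}^1A\,\pi_{\alpha,\beta}\,d\rho>0$. 4. The marginal posterior of $\rho$ is the probability measure on $(-1,1)$ with density $h(\rho)\pi_{\alpha,\beta}(\rho)/p(n,r)$. 5. For every integer $k\ge0$ the moment $E(\rho^k\mid n,r)$ exists and equals $\frac1{p(n,r)}\int_{-1}^1\rho^kA\,\pi_{\alpha,\beta}\,d\rho$ if $k$ is even and $\frac1{p(n,r)}\int_{-1}^1\rho^kB\,\pi_{\alpha,\beta}\,d\rho$ if $k$ is odd. Moreover $$E(\rho^k\mid n,r)=\begin{cases}\dfrac1{C\,p(n,r)}\displaystyle\sum_{m\ge0}\frac{(\frac{n-\gamma-1}2)_m(\frac{n-\delta-1}2)_m}{(\frac12)_m\,m!}\,a_{k,m}\,r^{2m}&k\text{ even},\\[2ex]\dfrac{2W}{C\,p(n,r)}\displaystyle\sum_{m\ge0}\frac{(\frac{n-\gamma}2)_m(\frac{n-\delta}2)_m}{(\frac32)_m\,m!}\,b_{k,m}\,r^{2m+1}&k\text{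 odd},\end{cases}$$ with convergent series, where $$a_{k,m}=\mathcal B\bigl(\tfrac{k+2m+1}2,\alpha+\tfrac{n-\gamma-\delta-1}2\bigr)\,{}_2F_1\bigl(-\tfrac\beta2,\tfrac{k+2m+1}2;\tfrac{k+2m+2\alpha+n-\gamma-\delta}2;-1\bigr),$$ $$b_{k,m}=\mathcal B\bigl(\tfrac{k+2m+2}2,\alpha+\tfrac{n-\gamma-\delta-1}2\bigr)\,{}_2F_1\bigl(-\tfrac\beta2,\tfrac{k+2m+2}2;\tfrac{k+2m+2\alpha+n-\gamma-\delta+1}2;-1\bigr).$$ 6. If $\beta/2$ is a non-negative integer, these series are hypergeometric: the ratio of consecutive coefficients is a rational function of $m$. -/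

import Mathlib

open MeasureTheory Set Filter Topology

noncomputable section

namespace CorrPosterior

/-! ### Gauss' hypergeometric function -/

/-- `w` is the value at the real point `z` of the analytic continuation of the Gauss series
`∑ (a)_m (b)_m / ((c)_m m!) x^m` (Mathlib's `ordinaryHypergeometric`, meaningful for `|x| < 1`)
from the origin along the segment from `0` to `z`. -/
def IsGaussValue (a b c z w : ℝ) : Prop :=
  ∃ f : ℝ → ℝ, AnalyticOnNhd ℝ f (segment ℝ 0 z) ∧
    f =ᶠ[𝓝 0] (fun x : ℝ => ordinaryHypergeometric a b c x) ∧ f z = w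

/-- The continued value is unique. -/
theorem IsGaussValue.unique {a b c z w w' : ℝ} (h : IsGaussValue a b c z w)
    (h' : IsGaussValue a b c z w') : w = w' := by
  obtain ⟨f, hf, hf0, rfl⟩ := h
  obtain ⟨g, hg, hg0, rfl⟩ := h'
  exact hf.eqOn_of_preconnected_of_eventuallyEq hg (convex_segment 0 z).isPreconnected
    (left_mem_segment ℝ 0 z) (hf0.trans hg0.symm) (right_mem_segment ℝ 0 z)

open Classical in
/-- Gauss' hypergeometric function `₂F₁(a, b; c; z)` for real parameters and real `z < 1`: the sum
of the Gauss series for `|z| < 1`, and its analytic continuation for `z ≤ -1`, in particular at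
`z = -1`, where the series itself need not converge. -/
def gauss2F1 (a b c z : ℝ) : ℝ :=
  if h : ∃ w, IsGaussValue a b c z w then h.choose else 0

theorem gauss2F1_eq {a b c z w : ℝ} (h : IsGaussValue a b c z w) : gauss2F1 a b c z = w := by
  have hex : ∃ w, IsGaussValue a b c z w := ⟨w, h⟩
  rw [gauss2F1, dif_pos hex]
  exact hex.choose_spec.unique h

/-- The Pochhammer symbol `(x)_m = x (x+1) ⋯ (x+m-1)`. -/
def poch (x : ℝ) (m : ℕ) : ℝ := (ascPochhammer ℝ m).eval x

/-- A sequence `c` is hypergeometric if `c (m+1) / c m` is a rational function of `m`. -/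
def IsHypergeometricSeq (c : ℕ → ℝ) : Prop :=
  ∃ P Q : Polynomial ℝ, ∀ m : ℕ,
    Q.eval (m : ℝ) ≠ 0 ∧ Q.eval (m : ℝ) * c (m + 1) = P.eval (m : ℝ) * c m

/-! ### The bivariate normal model, the prior and the posterior -/

/-- The summary `y = (n, x̄₁, x̄₂, s₁, s₂, r)` of `n` pairs of observations. -/
structure Summary where
  n : ℕ
  xbar1 : ℝ
  xbar2 : ℝ
  s1 : ℝ
  s2 : ℝ
  r : ℝ

/-- Nuisance parameters `θ₀ = (μ₁, μ₂, σ₁, σ₂)`. -/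
abbrev Nuisance : Type := ℝ × ℝ × ℝ × ℝ

/-- The range of the nuisance parameters: `μ₁, μ₂ ∈ ℝ` and `σ₁, σ₂ > 0`. -/
def nuisanceSet : Set Nuisance := univ ×ˢ univ ×ˢ Ioi 0 ×ˢ Ioi 0

/-- The range of the full parameter `θ = (θ₀, ρ)`, with `ρ ∈ (-1, 1)`. -/
def paramSet : Set (Nuisance × ℝ) := nuisanceSet ×ˢ Ioo (-1) 1

/-- The bivariate normal likelihood `f(y | θ₀, ρ)`. -/
def likelihood (y : Summary) : Nuisance → ℝ → ℝ
  | (μ1, μ2, σ1, σ2), ρ =>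
    ((2 * Real.pi * σ1 * σ2 * √(1 - ρ ^ 2)) ^ y.n)⁻¹ *
      Real.exp (-(y.n / (2 * (1 - ρ ^ 2))) *
        ((y.xbar1 - μ1) ^ 2 / σ1 ^ 2
          - 2 * ρ * ((y.xbar1 - μ1) * (y.xbar2 - μ2) / (σ1 * σ2))
          + (y.xbar2 - μ2) ^ 2 / σ2 ^ 2)) *
      Real.exp (-(y.n / (2 * (1 - ρ ^ 2))) *
        ((y.s1 / σ1) ^ 2 - 2 * ρ * (y.r * y.s1 * y.s2 / (σ1 * σ2)) + (y.s2 / σ2) ^ 2))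

/-- The prior `π_γ(σ₁) π_δ(σ₂) = σ₁^(γ-1) σ₂^(δ-1)` on the nuisance parameters (flat in the
means). -/
def priorNuisance (γ δ : ℝ) : Nuisance → ℝ
  | (_, _, σ1, σ2) => σ1 ^ (γ - 1) * σ2 ^ (δ - 1)

/-- The prior `π_{α,β}(ρ) = (1-ρ²)^(α-1) (1+ρ²)^(β/2) / C` on `ρ`, with scaling constant `C`. -/
def priorRho (C α β ρ : ℝ) : ℝ :=
  (1 - ρ ^ 2) ^ (α - 1) * (1 + ρ ^ 2) ^ (β / 2) / C

/-- `C_{α,β} = B(1/2, α) ₂F₁(-β/2, 1/2; α + 1/2; -1)`. -/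
def priorConst (α β : ℝ) : ℝ :=
  ProbabilityTheory.beta (1 / 2) α * gauss2F1 (-β / 2) (1 / 2) (α + 1 / 2) (-1)

/-- Likelihood times prior, `f(y | θ) π_η(θ)`. -/
def joint (y : Summary) (C α β γ δ : ℝ) (θ : Nuisance × ℝ) : ℝ :=
  likelihood y θ.1 θ.2 * (priorRho C α β θ.2 * priorNuisance γ δ θ.1)

/-- The marginal likelihood `p_η(y)`: all parameters integrated out. -/
def marginalLikelihood (y : Summary) (C α β γ δ : ℝ) : ℝ :=
  ∫ θ in paramSet, joint y C α β γ δ θ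

/-- `p_{γ,δ}(y₀)`: the marginal likelihood with `ρ` fixed at zero. -/
def nullMarginalLikelihood (y : Summary) (γ δ : ℝ) : ℝ :=
  ∫ θ₀ in nuisanceSet, likelihood y θ₀ 0 * priorNuisance γ δ θ₀

/-- The posterior distribution of `θ = (θ₀, ρ)` given `y` (Bayes' rule). -/
def posterior (y : Summary) (C α β γ δ : ℝ) : Measure (Nuisance × ℝ) :=
  (volume.restrict paramSet).withDensity fun θ =>
    ENNReal.ofReal (joint y C α β γ δ θ / marginalLikelihood y C α β γ δ)

/-- The marginal posterior distribution of `ρ`. -/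
def marginalPosterior (y : Summary) (C α β γ δ : ℝ) : Measure ℝ :=
  (posterior y C α β γ δ).map Prod.snd

/-- The `k`th posterior moment `E(ρ^k | y)`. -/
def posteriorMoment (y : Summary) (C α β γ δ : ℝ) (k : ℕ) : ℝ :=
  ∫ ρ, ρ ^ k ∂(marginalPosterior y C α β γ δ)

/-! ### The reduced likelihood -/

/-- `W_{γ,δ}(n)`. -/
def ratioW (n : ℕ) (γ δ : ℝ) : ℝ :=
  (Real.Gamma ((n - γ) / 2) * Real.Gamma ((n - δ) / 2)) /
    (Real.Gamma ((n - γ - 1) / 2) * Real.Gamma ((n - δ - 1) / 2))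

/-- The even part `A_{γ,δ}(n, r | ρ)`. -/
def partA (n : ℕ) (r γ δ ρ : ℝ) : ℝ :=
  (1 - ρ ^ 2) ^ ((n - γ - δ - 1) / 2) *
    gauss2F1 ((n - γ - 1) / 2) ((n - δ - 1) / 2) (1 / 2) (r ^ 2 * ρ ^ 2)

/-- The odd part `B_{γ,δ}(n, r | ρ)`. -/
def partB (n : ℕ) (r γ δ ρ : ℝ) : ℝ :=
  2 * r * ρ * (1 - ρ ^ 2) ^ ((n - γ - δ - 1) / 2) * ratioW n γ δ *
    gauss2F1 ((n - γ) / 2) ((n - δ) / 2) (3 / 2) (r ^ 2 * ρ ^ 2)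

/-- The reduced likelihood `h_{γ,δ}(n, r | ρ) = A + B`. -/
def reducedLikelihood (n : ℕ) (r γ δ ρ : ℝ) : ℝ :=
  partA n r γ δ ρ + partB n r γ δ ρ

/-- `p^{γ,δ}_{α,β}(n, r) = ∫ h_{γ,δ}(n, r | ρ) π_{α,β}(ρ) dρ`. -/
def normConst (n : ℕ) (r C α β γ δ : ℝ) : ℝ :=
  ∫ ρ in (-1 : ℝ)..1, reducedLikelihood n r γ δ ρ * priorRho C α β ρ

/-! ### The coefficients of the moment series -/

/-- `a_{k,m}`. -/
def coeffa (n : ℕ) (α β γ δ : ℝ) (k m : ℕ) : ℝ :=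
  ProbabilityTheory.beta (1 / 2 + (k + 2 * m) / 2) (α + (n - γ - δ - 1) / 2) *
    gauss2F1 (-β / 2) ((k + 2 * m + 1) / 2) ((k + 2 * m + 2 * α + n - γ - δ) / 2) (-1)

/-- `b_{k,m}`. -/
def coeffb (n : ℕ) (α β γ δ : ℝ) (k m : ℕ) : ℝ :=
  ProbabilityTheory.beta (1 / 2 + (k + 2 * m + 1) / 2) (α + (n - γ - δ - 1) / 2) *
    gauss2F1 (-β / 2) ((k + 2 * m + 2) / 2) ((k + 2 * m + 2 * α + n - γ - δ + 1) / 2) (-1)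

/-- Coefficient of `r^(2m)` in the even-moment series. -/
def evenCoeff (n : ℕ) (α β γ δ : ℝ) (k m : ℕ) : ℝ :=
  poch ((n - γ - 1) / 2) m * poch ((n - δ - 1) / 2) m / (poch (1 / 2) m * m.factorial) *
    coeffa n α β γ δ k m

/-- Coefficient of `r^(2m+1)` in the odd-moment series. -/
def oddCoeff (n : ℕ) (α β γ δ : ℝ) (k m : ℕ) : ℝ :=
  poch ((n - γ) / 2) m * poch ((n - δ) / 2) m / (poch (3 / 2) m * m.factorial) *
    coeffb n α β γ δ k m

end CorrPosterior

end

/-!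
Gaussian integration removes the means. In the remaining scale integral, expanding the exponential
of the cross term `2 ρ r s₁ s₂ / (σ₁ σ₂)` and integrating term by term gives products of Gamma
values: the even and the odd powers of `r ρ` sum to the two Gauss functions of `A` and `B`. The
prior on `ρ` is even, so exactly one of `A` and `B` contributes to each moment. The substitution
`t = ρ²` turns the moment of each power of `ρ` into an Euler integral
`∫ t ^ (b - 1) (1 - t) ^ (c - b - 1) (1 + t) ^ (β / 2)`, that is, into a Gauss function at `-1`;
this point lies on the boundary of the disc of convergence, and Pfaff's transformation moves it
to `1 / 2`. If `β / 2` is a natural number, the Gauss series terminates and such an integral is a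
Beta value times a rational function of `b`, so consecutive coefficients have rational ratios.
-/

namespace CorrPosterior

section Pochhammer

theorem poch_zero (x : ℝ) : poch x 0 = 1 := by simp [poch]

theorem poch_succ (x : ℝ) (m : ℕ) : poch x (m + 1) = poch x m * (x + m) :=
  ascPochhammer_succ_eval m x

theorem poch_pos {x : ℝ} (hx : 0 < x) (m : ℕ) : 0 < poch x m :=
  ascPochhammer_pos m x hx

theorem poch_add (x : ℝ) (i k : ℕ) : poch x (i + k) = poch x i * poch (x + i) k := by
  simp [poch, ← ascPochhammer_mul]

theorem gamma_add_natCast {x : ℝ} (hx : 0 < x) (m : ℕ) :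
    Real.Gamma (x + m) = poch x m * Real.Gamma x := by
  induction m with
  | zero => simp [poch_zero]
  | succ m ih =>
    rw [Nat.cast_succ, ← add_assoc, Real.Gamma_add_one (by positivity), ih, poch_succ]
    ring

theorem beta_add_natCast {b e : ℝ} (hb : 0 < b) (he : 0 < e) (m : ℕ) :
    ProbabilityTheory.beta (b + m) e =
      poch b m / poch (b + e) m * ProbabilityTheory.beta b e := by
  have hbe : 0 < b + e := by positivity
  have hpoch := (poch_pos hbe m).ne'
  have hGamma := (Real.Gamma_pos_of_pos hbe).ne'
  simp only [ProbabilityTheory.beta]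
  rw [add_right_comm b, gamma_add_natCast hb, gamma_add_natCast hbe]
  field_simp

theorem beta_comm (b e : ℝ) : ProbabilityTheory.beta b e = ProbabilityTheory.beta e b := by
  simp only [ProbabilityTheory.beta, add_comm, mul_comm]

end Pochhammer

section GaussSeries

/-- The coefficient `(a)_m (b)_m / ((c)_m m!)` of `z ^ m` in the Gauss series. -/
noncomputable def gaussCoeff (a b c : ℝ) (m : ℕ) : ℝ :=
  poch a m * poch b m / (poch c m * m.factorial)

theorem gaussCoeff_zero (a b c : ℝ) : gaussCoeff a b c 0 = 1 := by
  simp [gaussCoeff, poch_zero]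

theorem gaussCoeff_succ (a b : ℝ) {c : ℝ} (hc : 0 < c) (m : ℕ) :
    (c + m) * (1 + m) * gaussCoeff a b c (m + 1) = (a + m) * (b + m) * gaussCoeff a b c m := by
  have hpoch := (poch_pos hc m).ne'
  have hcm : c + m ≠ 0 := by positivity
  simp only [gaussCoeff, poch_succ, Nat.factorial_succ]
  push_cast
  field_simp
  ring

theorem gaussCoeff_pos {a b c : ℝ} (ha : 0 < a) (hb : 0 < b) (hc : 0 < c) (m : ℕ) :
    0 < gaussCoeff a b c m := by
  have := poch_pos ha m
  have := poch_pos hb m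
  have := poch_pos hc m
  unfold gaussCoeff
  positivity

theorem one_le_radius_ordinaryHypergeometricSeries (a b : ℝ) {c : ℝ} (hc : 0 < c) :
    1 ≤ (ordinaryHypergeometricSeries ℝ a b c).radius := by
  by_cases ha : ∃ k : ℕ, (k : ℝ) = -a
  · obtain ⟨k, hk⟩ := ha
    rw [show a = -(k : ℝ) by linarith, ordinaryHypergeometric_radius_top_of_neg_nat₁]
    exact le_top
  by_cases hb : ∃ k : ℕ, (k : ℝ) = -b
  · obtain ⟨k, hk⟩ := hb
    rw [show b = -(k : ℝ) by linarith, ordinaryHypergeometric_radius_top_of_neg_nat₂]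
    exact le_top
  push Not at ha hb
  have hcne (k : ℕ) : (k : ℝ) ≠ -c := by linarith [k.cast_nonneg (α := ℝ)]
  exact (ordinaryHypergeometricSeries_radius_eq_one ℝ a b c
    fun k => ⟨ha k, hb k, hcne k⟩).ge

theorem hasFPowerSeriesOnBall_ordinaryHypergeometric (a b : ℝ) {c : ℝ} (hc : 0 < c) :
    HasFPowerSeriesOnBall (fun x : ℝ => ordinaryHypergeometric a b c x)
      (ordinaryHypergeometricSeries ℝ a b c) 0 1 := by
  have h := one_le_radius_ordinaryHypergeometricSeries a b hc
  exact ((ordinaryHypergeometricSeries ℝ a b c).hasFPowerSeriesOnBall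
    (one_pos.trans_le h)).mono one_pos h

theorem analyticAt_ordinaryHypergeometric (a b : ℝ) {c z : ℝ} (hc : 0 < c) (hz : |z| < 1) :
    AnalyticAt ℝ (fun x : ℝ => ordinaryHypergeometric a b c x) z :=
  (hasFPowerSeriesOnBall_ordinaryHypergeometric a b hc).analyticAt_of_mem
    (by simpa [← ofReal_norm] using hz)

theorem gauss2F1_eq_ordinaryHypergeometric (a b : ℝ) {c z : ℝ} (hc : 0 < c) (hz : |z| < 1) :
    gauss2F1 a b c z = ordinaryHypergeometric a b c z := by
  refine gauss2F1_eq ⟨_, fun x hx => analyticAt_ordinaryHypergeometric a b hc ?_,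
    EventuallyEq.rfl, rfl⟩
  simpa using (convex_ball (0 : ℝ) 1).segment_subset (by simp) (by simpa using hz) hx

theorem hasSum_gauss2F1 (a b : ℝ) {c z : ℝ} (hc : 0 < c) (hz : |z| < 1) :
    HasSum (fun m => gaussCoeff a b c m * z ^ m) (gauss2F1 a b c z) := by
  have h := (hasFPowerSeriesOnBall_ordinaryHypergeometric a b hc).hasSum
    (y := z) (by simpa [← ofReal_norm] using hz)
  rw [zero_add, ← gauss2F1_eq_ordinaryHypergeometric a b hc hz] at h
  convert! h using 2 with m
  rw [ordinaryHypergeometricSeries_apply_eq, gaussCoeff, smul_eq_mul]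
  simp only [poch, div_eq_mul_inv, mul_inv]
  ring

theorem continuousAt_gauss2F1 (a b : ℝ) {c z : ℝ} (hc : 0 < c) (hz : |z| < 1) :
    ContinuousAt (gauss2F1 a b c) z := by
  refine (analyticAt_ordinaryHypergeometric a b hc hz).continuousAt.congr ?_
  filter_upwards [(isOpen_Iio.preimage continuous_abs).mem_nhds hz] with x hx
  exact (gauss2F1_eq_ordinaryHypergeometric a b hc hx).symm

theorem one_le_gauss2F1 {a b c z : ℝ} (ha : 0 < a) (hb : 0 < b) (hc : 0 < c) (hz : 0 ≤ z)
    (hz1 : z < 1) : 1 ≤ gauss2F1 a b c z := by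
  have h := hasSum_gauss2F1 a b hc (by rwa [abs_of_nonneg hz] : |z| < 1)
  simpa [gaussCoeff_zero] using
    le_hasSum h 0 fun m _ => mul_nonneg (gaussCoeff_pos ha hb hc m).le (pow_nonneg hz m)

theorem hasSum_one_sub_rpow_neg (a : ℝ) {x : ℝ} (hx : |x| < 1) :
    HasSum (fun m : ℕ => poch a m / m.factorial * x ^ m) ((1 - x) ^ (-a)) := by
  have h := (Real.one_add_rpow_hasFPowerSeriesOnBall_zero (a := -a)).hasSum
    (y := -x) (by simpa [← ofReal_norm] using hx)
  rw [binomialSeries_eq_ordinaryHypergeometricSeries (b := (1 : ℝ))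
    (fun k => by linarith [k.cast_nonneg (α := ℝ)]), zero_add, ← sub_eq_add_neg] at h
  convert! h using 2 with m
  have hneg : (⇑(-ContinuousLinearMap.id ℝ ℝ) ∘ fun _ : Fin m => -x) = fun _ => x := by
    ext
    simp
  have hpoch : (ascPochhammer ℝ m).eval 1 ≠ 0 := (poch_pos one_pos m).ne'
  rw [FormalMultilinearSeries.compContinuousLinearMap_apply, hneg,
    ordinaryHypergeometricSeries_apply_eq, neg_neg, smul_eq_mul, poch]
  field_simp

theorem hasSum_integral_mul_powerSeries {X : Type*} [MeasurableSpace X] {μ : Measure X}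
    {w u : X → ℝ} {c : ℕ → ℝ} {f : ℝ → ℝ} {z : ℝ} (hw : Integrable w μ)
    (hu : AEStronglyMeasurable u μ) (hu1 : ∀ᵐ x ∂μ, |u x| ≤ 1)
    (hf : ∀ x, |x| ≤ |z| → HasSum (fun m => c m * x ^ m) (f x)) :
    HasSum (fun m => c m * z ^ m * ∫ x, w x * u x ^ m ∂μ) (∫ x, w x * f (z * u x) ∂μ) := by
  have habs : Summable fun m => |c m| * |z| ^ m :=
    (hf z le_rfl).summable.abs.congr fun m => by rw [abs_mul, abs_pow]
  have h := hasSum_integral_of_dominated_convergence (μ := μ)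
    (F := fun m x => w x * (c m * (z * u x) ^ m)) (f := fun x => w x * f (z * u x))
    (fun m x => |w x| * (|c m| * |z| ^ m))
    (fun m => hw.aestronglyMeasurable.mul (by fun_prop))
    (fun m => by
      filter_upwards [hu1] with x hx
      rw [norm_mul, norm_mul, norm_pow, norm_mul]
      simp only [Real.norm_eq_abs]
      have := mul_le_of_le_one_right (abs_nonneg z) hx
      gcongr)
    (ae_of_all _ fun x => habs.mul_left _)
    (by
      simp_rw [tsum_mul_left]
      exact hw.abs.mul_const _)
    (by
      filter_upwards [hu1] with x hx
      refine (hf _ ?_).mul_left _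
      rw [abs_mul]
      exact mul_le_of_le_one_right (abs_nonneg z) hx)
  convert! h using 2 with m
  rw [← integral_const_mul]
  congr with x
  ring

end GaussSeries

section EulerIntegral

/-- The density `t ^ (b - 1) * (1 - t) ^ (e - 1)` of the beta integral `B(b, e)` on `(0, 1)`. -/
noncomputable def betaWeight (b e t : ℝ) : ℝ := t ^ (b - 1) * (1 - t) ^ (e - 1)

theorem betaWeight_pos {b e t : ℝ} (ht : t ∈ Ioo (0 : ℝ) 1) : 0 < betaWeight b e t :=
  mul_pos (Real.rpow_pos_of_pos ht.1 _) (Real.rpow_pos_of_pos (sub_pos.2 ht.2) _)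

theorem betaWeight_one_sub (b e t : ℝ) : betaWeight b e (1 - t) = betaWeight e b t := by
  rw [betaWeight, betaWeight, sub_sub_cancel, mul_comm]

theorem betaWeight_mul_pow {b e t : ℝ} (ht : 0 < t) (m : ℕ) :
    betaWeight b e t * t ^ m = betaWeight (b + m) e t := by
  rw [betaWeight, betaWeight, add_sub_right_comm, Real.rpow_add_natCast ht.ne']
  ring

theorem integral_betaWeight {b e : ℝ} (hb : 0 < b) (he : 0 < e) :
    ∫ t in Ioo (0 : ℝ) 1, betaWeight b e t = ProbabilityTheory.beta b e := by
  have hB := ProbabilityTheory.beta_pos hb he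
  have h := ProbabilityTheory.lintegral_betaPDF_eq_one hb he
  rw [ProbabilityTheory.lintegral_betaPDF, ← ENNReal.toReal_eq_one_iff,
    ← integral_eq_lintegral_of_nonneg_ae] at h
  · simp_rw [mul_assoc, integral_const_mul] at h
    rw [one_div, inv_mul_eq_one₀ hB.ne'] at h
    exact h.symm
  · refine ae_restrict_of_forall_mem measurableSet_Ioo fun t ht => ?_
    simp only [Pi.zero_apply, mul_assoc]
    exact mul_nonneg (by positivity) (betaWeight_pos ht).le
  · exact Measurable.aestronglyMeasurable (by fun_prop)

theorem integrableOn_betaWeight {b e : ℝ} (hb : 0 < b) (he : 0 < e) :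
    IntegrableOn (betaWeight b e) (Ioo 0 1) :=
  .of_integral_ne_zero (by
    rw [integral_betaWeight hb he]
    exact (ProbabilityTheory.beta_pos hb he).ne')

theorem integral_betaWeight_mul_pow {b e : ℝ} (hb : 0 < b) (he : 0 < e) (m : ℕ) :
    ∫ t in Ioo (0 : ℝ) 1, betaWeight b e t * t ^ m =
      poch b m / poch (b + e) m * ProbabilityTheory.beta b e := by
  rw [setIntegral_congr_fun measurableSet_Ioo fun t ht => betaWeight_mul_pow ht.1 m,
    integral_betaWeight (by positivity) he, beta_add_natCast hb he]

theorem integral_betaWeight_mul_rpow_of_abs_lt_one (a : ℝ) {b e z : ℝ} (hb : 0 < b) (he : 0 < e)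
    (hz : |z| < 1) :
    ∫ t in Ioo (0 : ℝ) 1, betaWeight b e t * (1 - z * t) ^ (-a) =
      ProbabilityTheory.beta b e * gauss2F1 a b (b + e) z := by
  have hbe : 0 < b + e := by positivity
  have habs : ∀ᵐ t ∂volume.restrict (Ioo (0 : ℝ) 1), |t| ≤ 1 :=
    ae_restrict_of_forall_mem measurableSet_Ioo fun t ht => abs_le.2 ⟨by linarith [ht.1], ht.2.le⟩
  refine (hasSum_integral_mul_powerSeries (integrableOn_betaWeight hb he) (by fun_prop) habs
    fun x hx => hasSum_one_sub_rpow_neg a (hx.trans_lt hz)).unique ?_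
  convert! (hasSum_gauss2F1 a b hbe hz).mul_left (ProbabilityTheory.beta b e) using 2 with m
  rw [integral_betaWeight_mul_pow hb he, gaussCoeff]
  have := (poch_pos hbe m).ne'
  field_simp

theorem integral_betaWeight_mul_rpow_reflect (a b e : ℝ) {z : ℝ} (hz : z < 1) :
    ∫ t in Ioo (0 : ℝ) 1, betaWeight b e t * (1 - z * t) ^ (-a) =
      (1 - z) ^ (-a) *
        ∫ t in Ioo (0 : ℝ) 1, betaWeight e b t * (1 - z / (z - 1) * t) ^ (-a) := by
  have hz0 : 0 < 1 - z := by linarith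
  have hreflect := intervalIntegral.integral_comp_sub_left (a := 0) (b := 1)
    (fun t => betaWeight e b t * (1 - z / (z - 1) * t) ^ (-a)) 1
  rw [sub_self, sub_zero] at hreflect
  simp only [← integral_Ioc_eq_integral_Ioo, ← intervalIntegral.integral_of_le zero_le_one]
  rw [← hreflect, ← intervalIntegral.integral_const_mul]
  refine intervalIntegral.integral_congr fun t ht => ?_
  rw [uIcc_of_le zero_le_one] at ht
  have hzt : 0 ≤ 1 - z * t := by
    have hconv : 1 - z * t = (1 - t) + t * (1 - z) := by ring
    rw [hconv]
    exact add_nonneg (sub_nonneg.2 ht.2) (mul_nonneg ht.1 hz0.le)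
  have hfactor : 1 - z / (z - 1) * (1 - t) = (1 - z * t) / (1 - z) := by
    have : z - 1 ≠ 0 := by linarith
    field_simp
    ring
  have hpow := (Real.rpow_pos_of_pos hz0 (-a)).ne'
  simp only [betaWeight_one_sub]
  rw [hfactor, Real.div_rpow hzt hz0.le]
  field_simp

theorem abs_div_sub_one_lt_one {z : ℝ} (hz : z < 1 / 2) : |z / (z - 1)| < 1 := by
  have hneg : z - 1 < 0 := by linarith
  rw [abs_div, div_lt_one (abs_pos.2 hneg.ne), abs_of_neg hneg, abs_lt]
  constructor <;> linarith

/-- The right-hand side `(1 - z) ^ (-a) * ₂F₁(a, e; c; z / (z - 1))` of Pfaff's transformation. -/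
noncomputable def pfaffTransform (a e c z : ℝ) : ℝ :=
  (1 - z) ^ (-a) * ordinaryHypergeometric a e c (z / (z - 1))

theorem analyticAt_pfaffTransform (a e : ℝ) {c z : ℝ} (hc : 0 < c) (hz : z < 1 / 2) :
    AnalyticAt ℝ (pfaffTransform a e c) z := by
  have hpow : ContDiffAt ℝ ⊤ (fun x : ℝ => (1 - x) ^ (-a)) z :=
    (contDiffAt_const.sub contDiffAt_id).rpow_const_of_ne (by simp only [id]; linarith)
  have hdiv : AnalyticAt ℝ (fun x : ℝ => x / (x - 1)) z :=
    analyticAt_id.div (analyticAt_id.sub analyticAt_const) (by linarith : z - 1 ≠ 0)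
  exact hpow.analyticAt.mul (AnalyticAt.fun_comp
    (analyticAt_ordinaryHypergeometric a e hc (abs_div_sub_one_lt_one hz)) hdiv)

theorem integral_betaWeight_mul_rpow_eq_pfaffTransform (a : ℝ) {b e z : ℝ} (hb : 0 < b)
    (he : 0 < e) (hz : z < 1 / 2) :
    ∫ t in Ioo (0 : ℝ) 1, betaWeight b e t * (1 - z * t) ^ (-a) =
      ProbabilityTheory.beta b e * pfaffTransform a e (b + e) z := by
  have habs := abs_div_sub_one_lt_one hz
  rw [integral_betaWeight_mul_rpow_reflect a b e (by linarith),
    integral_betaWeight_mul_rpow_of_abs_lt_one a he hb habs, beta_comm e b, add_comm e b,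
    gauss2F1_eq_ordinaryHypergeometric a e (by positivity) habs, pfaffTransform]
  ring

theorem isGaussValue_pfaffTransform (a : ℝ) {b e z : ℝ} (hb : 0 < b) (he : 0 < e)
    (hz : z < 1 / 2) : IsGaussValue a b (b + e) z (pfaffTransform a e (b + e) z) := by
  refine ⟨_, fun x hx => analyticAt_pfaffTransform a e (by positivity) ?_, ?_, rfl⟩
  · exact (convex_Iio (1 / 2 : ℝ)).segment_subset (by norm_num) hz hx
  · filter_upwards [Ioo_mem_nhds (by norm_num : (-(1 / 2) : ℝ) < 0)
      (by norm_num : (0 : ℝ) < 1 / 2)] with x hx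
    have hx1 : |x| < 1 := abs_lt.2 ⟨by linarith [hx.1], by linarith [hx.2]⟩
    -- near the origin both functions are quotients of the same Euler integral by `B(b, e)`
    have h := integral_betaWeight_mul_rpow_of_abs_lt_one a hb he hx1
    rw [integral_betaWeight_mul_rpow_eq_pfaffTransform a hb he hx.2,
      gauss2F1_eq_ordinaryHypergeometric a b (by positivity) hx1] at h
    exact mul_left_cancel₀ (ProbabilityTheory.beta_pos hb he).ne' h

theorem integral_betaWeight_mul_rpow (a : ℝ) {b e z : ℝ} (hb : 0 < b) (he : 0 < e) (hz : z < 1) :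
    ∫ t in Ioo (0 : ℝ) 1, betaWeight b e t * (1 - z * t) ^ (-a) =
      ProbabilityTheory.beta b e * gauss2F1 a b (b + e) z := by
  rcases lt_or_ge z (1 / 2) with hz2 | hz2
  · rw [integral_betaWeight_mul_rpow_eq_pfaffTransform a hb he hz2,
      gauss2F1_eq (isGaussValue_pfaffTransform a hb he hz2)]
  · exact integral_betaWeight_mul_rpow_of_abs_lt_one a hb he
      (abs_lt.2 ⟨by linarith, hz⟩)

/-- The value `B(b, e) ₂F₁(-β/2, b; b + e; -1)` of Euler's integral for `(1 + t) ^ (β / 2)`. -/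
noncomputable def eulerValue (β e b : ℝ) : ℝ :=
  ProbabilityTheory.beta b e * gauss2F1 (-β / 2) b (b + e) (-1)

theorem integral_betaWeight_mul_eq_eulerValue (β : ℝ) {e b : ℝ} (he : 0 < e) (hb : 0 < b) :
    ∫ t in Ioo (0 : ℝ) 1, betaWeight b e t * (1 + t) ^ (β / 2) = eulerValue β e b := by
  rw [eulerValue, ← integral_betaWeight_mul_rpow _ hb he (by norm_num)]
  simp [neg_div]

theorem integrableOn_betaWeight_mul_one_add_rpow (β : ℝ) {e b : ℝ} (he : 0 < e) (hb : 0 < b) :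
    IntegrableOn (fun t => betaWeight b e t * (1 + t) ^ (β / 2)) (Ioo 0 1) := by
  have h := integrableOn_betaWeight hb he
  rw [← integrableOn_Icc_iff_integrableOn_Ioo] at h ⊢
  exact h.mul_continuousOn
    (ContinuousOn.rpow_const (by fun_prop) fun t ht => Or.inl (by linarith [ht.1])) isCompact_Icc

theorem eulerValue_pos (β : ℝ) {e b : ℝ} (he : 0 < e) (hb : 0 < b) : 0 < eulerValue β e b := by
  rw [← integral_betaWeight_mul_eq_eulerValue β he hb, ← integral_Ioc_eq_integral_Ioo,
    ← intervalIntegral.integral_of_le zero_le_one]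
  refine intervalIntegral.intervalIntegral_pos_of_pos_on
    ((intervalIntegrable_iff_integrableOn_Ioo_of_le zero_le_one).2
      (integrableOn_betaWeight_mul_one_add_rpow β he hb)) (fun t ht => ?_) one_pos
  exact mul_pos (betaWeight_pos ht) (Real.rpow_pos_of_pos (by linarith [ht.1]) _)

end EulerIntegral

section CorrelationWeight

theorem integral_eq_zero_of_odd {f : ℝ → ℝ} (hf : ∀ x, f (-x) = -f x) (a : ℝ) :
    ∫ x in (-a)..a, f x = 0 := by
  have h := intervalIntegral.integral_comp_neg (a := -a) (b := a) f
  simp only [hf, intervalIntegral.integral_neg, neg_neg] at h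
  linarith

theorem intervalIntegrable_neg_of_even {f : ℝ → ℝ} {a : ℝ} (hf : ∀ x, f (-x) = f x)
    (hi : IntervalIntegrable f volume 0 a) : IntervalIntegrable f volume (-a) 0 := by
  simpa [hf] using (IntervalIntegrable.iff_comp_neg).1 hi.symm

theorem integral_eq_two_mul_of_even {f : ℝ → ℝ} {a : ℝ} (hf : ∀ x, f (-x) = f x)
    (hi : IntervalIntegrable f volume 0 a) :
    ∫ x in (-a)..a, f x = 2 * ∫ x in (0 : ℝ)..a, f x := by
  have h := intervalIntegral.integral_comp_neg (a := -a) (b := 0) f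
  simp only [hf, neg_neg, neg_zero] at h
  rw [← intervalIntegral.integral_add_adjacent_intervals (intervalIntegrable_neg_of_even hf hi) hi,
    h, two_mul]

theorem image_sq_Ioo_zero_one : (fun x : ℝ => x ^ 2) '' Ioo 0 1 = Ioo 0 1 := by
  ext t
  constructor
  · rintro ⟨x, hx, rfl⟩
    exact ⟨pow_pos hx.1 2, pow_lt_one₀ hx.1.le hx.2 two_ne_zero⟩
  · intro ht
    exact ⟨√t, ⟨Real.sqrt_pos.2 ht.1, (Real.sqrt_lt' one_pos).2 (by simpa using ht.2)⟩,
      Real.sq_sqrt ht.1.le⟩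

theorem injOn_sq_Ioo_zero_one : InjOn (fun x : ℝ => x ^ 2) (Ioo 0 1) := fun _ hx _ hy h =>
  (pow_left_inj₀ hx.1.le hy.1.le two_ne_zero).1 h

theorem hasDerivWithinAt_sq (s : Set ℝ) (x : ℝ) :
    HasDerivWithinAt (fun x : ℝ => x ^ 2) (2 * x) s x := by
  simpa using (hasDerivAt_pow 2 x).hasDerivWithinAt

theorem abs_deriv_sq_smul_rpow_mul (φ : ℝ → ℝ) (l : ℕ) {x : ℝ} (hx : 0 < x) :
    |2 * x| • ((x ^ 2) ^ ((l : ℝ) + 1 / 2 - 1) * φ (x ^ 2)) =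
      2 * (x ^ (2 * l) * φ (x ^ 2)) := by
  have hpow : x ^ (2 * l) = (x ^ 2) ^ ((l : ℝ) + 1 / 2 - 1) * x := by
    rw [← Real.rpow_natCast x 2, ← Real.rpow_mul hx.le, ← Real.rpow_add_one hx.ne',
      ← Real.rpow_natCast]
    congr 1
    push_cast
    ring
  rw [hpow, abs_of_pos (by positivity), smul_eq_mul]
  ring

theorem integrableOn_pow_mul_comp_sq_iff (φ : ℝ → ℝ) (l : ℕ) :
    IntegrableOn (fun x => x ^ (2 * l) * φ (x ^ 2)) (Ioo 0 1) ↔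
      IntegrableOn (fun t => t ^ ((l : ℝ) + 1 / 2 - 1) * φ t) (Ioo 0 1) := by
  conv_rhs => rw [← image_sq_Ioo_zero_one]
  rw [integrableOn_image_iff_integrableOn_abs_deriv_smul measurableSet_Ioo
      (fun x _ => hasDerivWithinAt_sq _ x) injOn_sq_Ioo_zero_one,
    integrableOn_congr_fun (fun x hx => abs_deriv_sq_smul_rpow_mul φ l hx.1) measurableSet_Ioo]
  exact (integrable_const_mul_iff (isUnit_iff_ne_zero.2 two_ne_zero) _).symm

theorem integral_pow_mul_comp_sq (φ : ℝ → ℝ) (l : ℕ) :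
    2 * ∫ x in Ioo (0 : ℝ) 1, x ^ (2 * l) * φ (x ^ 2) =
      ∫ t in Ioo (0 : ℝ) 1, t ^ ((l : ℝ) + 1 / 2 - 1) * φ t := by
  conv_rhs => rw [← image_sq_Ioo_zero_one]
  rw [integral_image_eq_integral_abs_deriv_smul measurableSet_Ioo
      (fun x _ => hasDerivWithinAt_sq _ x) injOn_sq_Ioo_zero_one,
    setIntegral_congr_fun measurableSet_Ioo fun x hx => abs_deriv_sq_smul_rpow_mul φ l hx.1,
    integral_const_mul]

/-- The weight `(1 - ρ ^ 2) ^ (e - 1) * (1 + ρ ^ 2) ^ (β / 2)` on `(-1, 1)`: both the prior on `ρ`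
and its product with the power of `1 - ρ ^ 2` in the likelihood are of this form. -/
noncomputable def rhoWeight (e β ρ : ℝ) : ℝ := (1 - ρ ^ 2) ^ (e - 1) * (1 + ρ ^ 2) ^ (β / 2)

theorem one_sub_sq_pos {ρ : ℝ} (hρ : ρ ∈ Ioo (-1 : ℝ) 1) : 0 < 1 - ρ ^ 2 := by
  nlinarith [hρ.1, hρ.2]

theorem rhoWeight_pos {e β ρ : ℝ} (hρ : ρ ∈ Ioo (-1 : ℝ) 1) : 0 < rhoWeight e β ρ :=
  mul_pos (Real.rpow_pos_of_pos (one_sub_sq_pos hρ) _) (Real.rpow_pos_of_pos (by positivity) _)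

theorem rhoWeight_neg (e β ρ : ℝ) : rhoWeight e β (-ρ) = rhoWeight e β ρ := by
  simp [rhoWeight]

theorem pow_mul_rhoWeight_neg (e β : ℝ) (l : ℕ) (ρ : ℝ) :
    (-ρ) ^ (2 * l) * rhoWeight e β (-ρ) = ρ ^ (2 * l) * rhoWeight e β ρ := by
  rw [rhoWeight_neg, (even_two_mul l).neg_pow]

theorem intervalIntegrable_zero_one_pow_mul_rhoWeight (β : ℝ) {e : ℝ} (he : 0 < e) (l : ℕ) :
    IntervalIntegrable (fun ρ => ρ ^ (2 * l) * rhoWeight e β ρ) volume 0 1 := by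
  rw [intervalIntegrable_iff_integrableOn_Ioo_of_le zero_le_one]
  refine (integrableOn_pow_mul_comp_sq_iff
    (fun t => (1 - t) ^ (e - 1) * (1 + t) ^ (β / 2)) l).2 ?_
  simpa only [betaWeight, mul_assoc] using
    integrableOn_betaWeight_mul_one_add_rpow β he (by positivity : (0 : ℝ) < l + 1 / 2)

theorem intervalIntegrable_pow_mul_rhoWeight (β : ℝ) {e : ℝ} (he : 0 < e) (l : ℕ) :
    IntervalIntegrable (fun ρ => ρ ^ (2 * l) * rhoWeight e β ρ) volume (-1) 1 :=
  have h := intervalIntegrable_zero_one_pow_mul_rhoWeight β he l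
  (intervalIntegrable_neg_of_even (pow_mul_rhoWeight_neg e β l) h).trans h

theorem integral_pow_mul_rhoWeight (β : ℝ) {e : ℝ} (he : 0 < e) (l : ℕ) :
    ∫ ρ in (-1 : ℝ)..1, ρ ^ (2 * l) * rhoWeight e β ρ = eulerValue β e (l + 1 / 2) := by
  rw [integral_eq_two_mul_of_even (pow_mul_rhoWeight_neg e β l)
      (intervalIntegrable_zero_one_pow_mul_rhoWeight β he l),
    intervalIntegral.integral_of_le zero_le_one, integral_Ioc_eq_integral_Ioo,
    ← integral_betaWeight_mul_eq_eulerValue β he (by positivity)]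
  simpa only [betaWeight, rhoWeight, mul_assoc] using
    integral_pow_mul_comp_sq (fun t => (1 - t) ^ (e - 1) * (1 + t) ^ (β / 2)) l

theorem intervalIntegrable_rhoWeight (β : ℝ) {e : ℝ} (he : 0 < e) :
    IntervalIntegrable (rhoWeight e β) volume (-1) 1 := by
  simpa using intervalIntegrable_pow_mul_rhoWeight β he 0

theorem integral_rhoWeight (β : ℝ) {e : ℝ} (he : 0 < e) :
    ∫ ρ in (-1 : ℝ)..1, rhoWeight e β ρ = eulerValue β e (1 / 2) := by
  simpa using integral_pow_mul_rhoWeight β he 0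

theorem abs_sq_mul_sq_lt_one {r ρ : ℝ} (hr : |r| < 1) (hρ : ρ ∈ Icc (-1 : ℝ) 1) :
    |r ^ 2 * ρ ^ 2| < 1 := by
  rw [abs_of_nonneg (by positivity), ← mul_pow, sq_lt_one_iff_abs_lt_one, abs_mul]
  exact (mul_le_of_le_one_right (abs_nonneg r) (abs_le.2 hρ)).trans_lt hr

theorem continuousOn_gauss2F1_sq (a b : ℝ) {c r : ℝ} (hc : 0 < c) (hr : |r| < 1) :
    ContinuousOn (fun ρ => gauss2F1 a b c (r ^ 2 * ρ ^ 2)) (Icc (-1) 1) := fun ρ hρ =>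
  ((continuousAt_gauss2F1 a b hc (abs_sq_mul_sq_lt_one hr hρ)).comp
    (f := fun ρ : ℝ => r ^ 2 * ρ ^ 2) (by fun_prop)).continuousWithinAt

theorem intervalIntegrable_mul_gauss2F1_mul_rhoWeight (a b β : ℝ) {c e r : ℝ} (hc : 0 < c)
    (he : 0 < e) (hr : |r| < 1) {g : ℝ → ℝ} (hg : Continuous g) :
    IntervalIntegrable (fun ρ => g ρ * gauss2F1 a b c (r ^ 2 * ρ ^ 2) * rhoWeight e β ρ)
      volume (-1) 1 := by
  refine (intervalIntegrable_rhoWeight β he).continuousOn_mul ?_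
  rw [uIcc_of_le (by norm_num)]
  exact hg.continuousOn.mul (continuousOn_gauss2F1_sq a b hc hr)

theorem hasSum_integral_pow_mul_gauss2F1_mul_rhoWeight (a b β : ℝ) {c e r : ℝ} (hc : 0 < c)
    (he : 0 < e) (hr : |r| < 1) (l : ℕ) :
    HasSum (fun m : ℕ => gaussCoeff a b c m * eulerValue β e (l + 1 / 2 + m) * r ^ (2 * m))
      (∫ ρ in (-1 : ℝ)..1, ρ ^ (2 * l) * gauss2F1 a b c (r ^ 2 * ρ ^ 2) * rhoWeight e β ρ) := by
  have hw := (intervalIntegrable_pow_mul_rhoWeight β he l).1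
  have hsq : ∀ᵐ ρ ∂volume.restrict (Ioc (-1 : ℝ) 1), |ρ ^ 2| ≤ 1 :=
    ae_restrict_of_forall_mem measurableSet_Ioc fun ρ hρ => by
      rw [abs_pow]
      exact pow_le_one₀ (abs_nonneg ρ) (abs_le.2 ⟨hρ.1.le, hρ.2⟩)
  have hr2 : |r ^ 2| < 1 := by simpa using hr
  have h := hasSum_integral_mul_powerSeries hw (by fun_prop) hsq
    fun x hx => hasSum_gauss2F1 a b hc (hx.trans_lt hr2)
  simp only [mul_right_comm _ (rhoWeight _ _ _), ← pow_mul, ← pow_add, ← mul_add,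
    ← intervalIntegral.integral_of_le (by norm_num : (-1 : ℝ) ≤ 1),
    integral_pow_mul_rhoWeight β he] at h
  convert! h using 2 with m
  rw [mul_right_comm, Nat.cast_add, add_right_comm]

end CorrelationWeight

section HypergeometricSequences

open Polynomial

theorem IsHypergeometricSeq.mul {c d : ℕ → ℝ} (hc : IsHypergeometricSeq c)
    (hd : IsHypergeometricSeq d) : IsHypergeometricSeq fun m => c m * d m := by
  obtain ⟨P, Q, h⟩ := hc
  obtain ⟨P', Q', h'⟩ := hd
  refine ⟨P * P', Q * Q', fun m => ⟨?_, ?_⟩⟩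
  · rw [eval_mul]
    exact mul_ne_zero (h m).1 (h' m).1
  · rw [eval_mul, eval_mul, mul_mul_mul_comm, (h m).2, (h' m).2, mul_mul_mul_comm]

theorem isHypergeometricSeq_eval_div_eval {N D : ℝ[X]} (hN : ∀ m : ℕ, N.eval (m : ℝ) ≠ 0)
    (hD : ∀ m : ℕ, D.eval (m : ℝ) ≠ 0) :
    IsHypergeometricSeq fun m => N.eval (m : ℝ) / D.eval (m : ℝ) := by
  refine ⟨N.comp (X + 1) * D, N * D.comp (X + 1), fun m => ?_⟩
  have hD' := hD (m + 1)
  have := hN m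
  have := hD m
  simp only [eval_mul, eval_comp, eval_add, eval_X, eval_one, Nat.cast_add, Nat.cast_one]
    at hD' ⊢
  exact ⟨by positivity, by field_simp⟩

theorem isHypergeometricSeq_gaussCoeff (a b : ℝ) {c : ℝ} (hc : 0 < c) :
    IsHypergeometricSeq (gaussCoeff a b c) := by
  refine ⟨(C a + X) * (C b + X), (C c + X) * (1 + X), fun m => ?_⟩
  simp only [eval_mul, eval_add, eval_X, eval_C, eval_one]
  exact ⟨by positivity, gaussCoeff_succ a b hc m⟩

theorem isHypergeometricSeq_beta {x e : ℝ} (hx : 0 < x) (he : 0 < e) :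
    IsHypergeometricSeq fun m => ProbabilityTheory.beta (x + m) e := by
  refine ⟨C x + X, C (x + e) + X, fun m => ?_⟩
  simp only [eval_add, eval_X, eval_C]
  refine ⟨by positivity, ?_⟩
  have h := beta_add_natCast (by positivity : 0 < x + m) he 1
  simp only [poch_succ, poch_zero, Nat.cast_zero, add_zero, one_mul, Nat.cast_one] at h
  rw [Nat.cast_succ, ← add_assoc, h]
  field_simp
  ring

theorem eulerValue_two_mul_natCast_eq_sum_beta {e b : ℝ} (he : 0 < e) (hb : 0 < b) (j : ℕ) :
    eulerValue (2 * j) e b =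
      ∑ i ∈ Finset.range (j + 1), (j.choose i : ℝ) * ProbabilityTheory.beta (b + i) e := by
  have hexpand (t : ℝ) (ht : t ∈ Ioo (0 : ℝ) 1) :
      betaWeight b e t * (1 + t) ^ ((2 * j : ℝ) / 2) =
        ∑ i ∈ Finset.range (j + 1), (j.choose i : ℝ) * betaWeight (b + i) e t := by
    rw [mul_div_cancel_left₀ _ two_ne_zero, Real.rpow_natCast, add_comm, add_pow, Finset.mul_sum]
    refine Finset.sum_congr rfl fun i _ => ?_
    rw [← betaWeight_mul_pow ht.1, one_pow]
    ring
  rw [← integral_betaWeight_mul_eq_eulerValue _ he hb,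
    setIntegral_congr_fun measurableSet_Ioo hexpand, integral_finsetSum _ fun i _ =>
      (integrableOn_betaWeight (by positivity) he).const_mul _]
  refine Finset.sum_congr rfl fun i _ => ?_
  rw [integral_const_mul, integral_betaWeight (by positivity) he]

/-- The polynomial in `b` that, divided by `(b + e)_j`, gives the ratio of `eulerValue (2 * j) e b`
to `B(b, e)`. -/
noncomputable def eulerNumerator (e : ℝ) (j : ℕ) : ℝ[X] :=
  ∑ i ∈ Finset.range (j + 1),
    C (j.choose i : ℝ) * ascPochhammer ℝ i * (ascPochhammer ℝ (j - i)).comp (X + C (e + i))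

theorem eval_eulerNumerator (e b : ℝ) (j : ℕ) :
    (eulerNumerator e j).eval b =
      ∑ i ∈ Finset.range (j + 1), j.choose i * poch b i * poch (b + e + i) (j - i) := by
  simp [eulerNumerator, eval_finsetSum, poch, eval_comp, add_assoc]

theorem eval_eulerNumerator_pos {e b : ℝ} (he : 0 < e) (hb : 0 < b) (j : ℕ) :
    0 < (eulerNumerator e j).eval b := by
  rw [eval_eulerNumerator]
  refine Finset.sum_pos (fun i hi => ?_) (by simp)
  have hchoose : 0 < j.choose i := Nat.choose_pos (Finset.mem_range_succ_iff.1 hi)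
  have := poch_pos hb i
  have := poch_pos (by positivity : 0 < b + e + i) (j - i)
  positivity

theorem eulerValue_two_mul_natCast {e b : ℝ} (he : 0 < e) (hb : 0 < b) (j : ℕ) :
    eulerValue (2 * j) e b =
      (eulerNumerator e j).eval b / poch (b + e) j * ProbabilityTheory.beta b e := by
  rw [eulerValue_two_mul_natCast_eq_sum_beta he hb, eval_eulerNumerator, Finset.sum_div,
    Finset.sum_mul]
  refine Finset.sum_congr rfl fun i hi => ?_
  have hsplit : poch (b + e) j = poch (b + e) i * poch (b + e + i) (j - i) := by
    rw [← poch_add, Nat.add_sub_cancel' (Finset.mem_range_succ_iff.1 hi)]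
  have := (poch_pos (by positivity : 0 < b + e) i).ne'
  have := (poch_pos (by positivity : 0 < b + e + i) (j - i)).ne'
  rw [beta_add_natCast hb he, hsplit]
  field_simp

theorem isHypergeometricSeq_eulerValue {x e : ℝ} (hx : 0 < x) (he : 0 < e) (j : ℕ) :
    IsHypergeometricSeq fun m => eulerValue (2 * j) e (x + m) := by
  have hN (m : ℕ) : ((eulerNumerator e j).comp (C x + X)).eval (m : ℝ) =
      (eulerNumerator e j).eval (x + m) := by
    simp [eval_comp]
  have hD (m : ℕ) : ((ascPochhammer ℝ j).comp (C (x + e) + X)).eval (m : ℝ) =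
      poch (x + m + e) j := by
    simp [eval_comp, poch, add_right_comm]
  convert! (isHypergeometricSeq_eval_div_eval (N := (eulerNumerator e j).comp (C x + X))
    (D := (ascPochhammer ℝ j).comp (C (x + e) + X)) (fun m => ?_) (fun m => ?_)).mul
    (isHypergeometricSeq_beta hx he) using 2 with m
  · rw [hN, hD]
    exact eulerValue_two_mul_natCast he (by positivity) j
  · rw [hN]
    exact (eval_eulerNumerator_pos he (by positivity) j).ne'
  · rw [hD]
    exact (poch_pos (by positivity) j).ne'

end HypergeometricSequences

section ScaleIntegral

theorem factorial_two_mul (m : ℕ) :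
    ((2 * m).factorial : ℝ) = 4 ^ m * (poch (1 / 2) m * m.factorial) := by
  induction m with
  | zero => simp [poch_zero]
  | succ m ih =>
    rw [show 2 * (m + 1) = 2 * m + 1 + 1 by ring, Nat.factorial_succ, Nat.factorial_succ,
      Nat.factorial_succ, poch_succ]
    push_cast
    rw [ih]
    ring

theorem factorial_two_mul_add_one (m : ℕ) :
    ((2 * m + 1).factorial : ℝ) = 4 ^ m * (poch (3 / 2) m * m.factorial) := by
  induction m with
  | zero => simp [poch_zero]
  | succ m ih =>
    rw [show 2 * (m + 1) + 1 = 2 * m + 1 + 1 + 1 by ring, Nat.factorial_succ,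
      Nat.factorial_succ (2 * m + 1), Nat.factorial_succ m, poch_succ]
    push_cast
    rw [ih]
    ring

/-- The value `∬ x^(a-1) y^(b-1) exp(-x - y + 2c√(xy)) dx dy` over the positive quadrant of a
gamma integral with correlated variables, for `|c| < 1`. It is defined by its closed form, in which
the two summands are the even and the odd part in `c`. -/
noncomputable def correlatedGamma (a b c : ℝ) : ℝ :=
  Real.Gamma a * Real.Gamma b * gauss2F1 a b (1 / 2) (c ^ 2) +
    2 * c * (Real.Gamma (a + 1 / 2) * Real.Gamma (b + 1 / 2)) *
      gauss2F1 (a + 1 / 2) (b + 1 / 2) (3 / 2) (c ^ 2)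

theorem hasSum_correlatedGamma {a b c : ℝ} (ha : 0 < a) (hb : 0 < b) (hc : |c| < 1) :
    HasSum (fun j : ℕ => (2 * c) ^ j / j.factorial *
      (Real.Gamma (a + j / 2) * Real.Gamma (b + j / 2))) (correlatedGamma a b c) := by
  have hc2 : |c ^ 2| < 1 := by
    rw [abs_pow]
    exact pow_lt_one₀ (abs_nonneg c) hc two_ne_zero
  refine HasSum.even_add_odd ?_ ?_
  · convert! (hasSum_gauss2F1 a b one_half_pos hc2).mul_left
      (Real.Gamma a * Real.Gamma b) using 2 with m
    have half_cast : ((2 * m : ℕ) : ℝ) / 2 = m := by push_cast; ring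
    have := (poch_pos (one_half_pos (α := ℝ)) m).ne'
    rw [half_cast, gamma_add_natCast ha, gamma_add_natCast hb, factorial_two_mul, gaussCoeff,
      pow_mul, mul_pow, mul_pow, show (2 : ℝ) ^ 2 = 4 by norm_num]
    field_simp
  · convert! (hasSum_gauss2F1 (a + 1 / 2) (b + 1 / 2) (by norm_num : (0 : ℝ) < 3 / 2)
      hc2).mul_left (2 * c * (Real.Gamma (a + 1 / 2) * Real.Gamma (b + 1 / 2))) using 2 with m
    have add_half_cast (u : ℝ) : u + ((2 * m + 1 : ℕ) : ℝ) / 2 = u + 1 / 2 + m := by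
      push_cast; ring
    have := (poch_pos (by norm_num : (0 : ℝ) < 3 / 2) m).ne'
    rw [add_half_cast, add_half_cast, gamma_add_natCast (by positivity),
      gamma_add_natCast (by positivity), factorial_two_mul_add_one, gaussCoeff, pow_succ, pow_mul,
      mul_pow, mul_pow, show (2 : ℝ) ^ 2 = 4 by norm_num]
    field_simp

theorem correlatedGamma_pos {a b c : ℝ} (ha : 0 < a) (hb : 0 < b) (hc : 0 ≤ c) (hc1 : c < 1) :
    0 < correlatedGamma a b c := by
  have hc2 : c ^ 2 < 1 := by nlinarith
  have := one_le_gauss2F1 ha hb (by norm_num : (0 : ℝ) < 1 / 2) (sq_nonneg c) hc2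
  have := one_le_gauss2F1 (by positivity : 0 < a + 1 / 2) (by positivity : 0 < b + 1 / 2)
    (by norm_num : (0 : ℝ) < 3 / 2) (sq_nonneg c) hc2
  have := Real.Gamma_pos_of_pos ha
  have := Real.Gamma_pos_of_pos hb
  have := Real.Gamma_pos_of_pos (by positivity : 0 < a + 1 / 2)
  have := Real.Gamma_pos_of_pos (by positivity : 0 < b + 1 / 2)
  unfold correlatedGamma
  positivity

/-- The inverse-gamma type kernel `σ^(-2p-1) exp(-(t/σ)²)` of a single scale parameter. -/
noncomputable def scaleKernel (p t σ : ℝ) : ℝ := σ ^ (-2 * p - 1) * Real.exp (-(t / σ) ^ 2)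

theorem scaleKernel_nonneg {p t σ : ℝ} (hσ : 0 < σ) : 0 ≤ scaleKernel p t σ := by
  unfold scaleKernel
  positivity

theorem integral_scaleKernel {p t : ℝ} (hp : 0 < p) (ht : 0 < t) :
    ∫ σ in Ioi (0 : ℝ), scaleKernel p t σ = t ^ (-2 * p) * Real.Gamma p / 2 := by
  have h := integral_comp_rpow_Ioi (fun x : ℝ => x ^ (p - 1) * Real.exp (-(t ^ 2 * x)))
    (by norm_num : (-2 : ℝ) ≠ 0)
  have hsubst : ∀ σ ∈ Ioi (0 : ℝ), (|(-2 : ℝ)| * σ ^ ((-2 : ℝ) - 1)) •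
      ((σ ^ (-2 : ℝ)) ^ (p - 1) * Real.exp (-(t ^ 2 * σ ^ (-2 : ℝ)))) =
        2 * scaleKernel p t σ := by
    intro σ (hσ : 0 < σ)
    have hpow : σ ^ (-2 * p - 1) = σ ^ ((-2 : ℝ) - 1) * σ ^ (-2 * (p - 1)) := by
      rw [← Real.rpow_add hσ]
      congr 1
      ring
    rw [smul_eq_mul, scaleKernel, ← Real.rpow_mul hσ.le, abs_neg, abs_two, hpow,
      Real.rpow_neg hσ.le, Real.rpow_two, div_pow, div_eq_mul_inv]
    ring
  have hconst : (1 / t ^ 2) ^ p = t ^ (-2 * p) := by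
    rw [one_div, Real.inv_rpow (by positivity), ← Real.rpow_neg (by positivity), ← Real.rpow_two,
      ← Real.rpow_mul ht.le]
    congr 1
    ring
  rw [Real.integral_rpow_mul_exp_neg_mul_Ioi hp (by positivity), hconst,
    setIntegral_congr_fun measurableSet_Ioi hsubst, integral_const_mul] at h
  linarith

theorem integrableOn_scaleKernel {p t : ℝ} (hp : 0 < p) (ht : 0 < t) :
    IntegrableOn (scaleKernel p t) (Ioi 0) :=
  .of_integral_ne_zero (by
    rw [integral_scaleKernel hp ht]
    have := Real.Gamma_pos_of_pos hp
    positivity)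

theorem scaleKernel_mul_pow {p σ : ℝ} (t : ℝ) (hσ : 0 < σ) (j : ℕ) :
    scaleKernel p t σ * (t / σ) ^ j = t ^ j * scaleKernel (p + j / 2) t σ := by
  have hexp : -2 * (p + j / 2) - 1 = (-2 * p - 1) + -(j : ℝ) := by ring
  rw [scaleKernel, scaleKernel, hexp, Real.rpow_add hσ, Real.rpow_neg hσ.le, Real.rpow_natCast,
    div_pow t σ j, div_eq_mul_inv (t ^ j)]
  ring

theorem integral_scaleKernel_mul_pow {p t : ℝ} (hp : 0 < p) (ht : 0 < t) (j : ℕ) :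
    ∫ σ in Ioi (0 : ℝ), scaleKernel p t σ * (t / σ) ^ j =
      t ^ (-2 * p) * Real.Gamma (p + j / 2) / 2 := by
  rw [setIntegral_congr_fun measurableSet_Ioi fun σ hσ => scaleKernel_mul_pow t hσ j,
    integral_const_mul, integral_scaleKernel (by positivity) ht,
    show -2 * (p + (j : ℝ) / 2) = -2 * p - j by ring, Real.rpow_sub_natCast ht.ne']
  field_simp

theorem integrableOn_scaleKernel_mul_pow {p t : ℝ} (hp : 0 < p) (ht : 0 < t) (j : ℕ) :
    IntegrableOn (fun σ => scaleKernel p t σ * (t / σ) ^ j) (Ioi 0) :=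
  IntegrableOn.congr_fun
    ((integrableOn_scaleKernel (by positivity : 0 < p + j / 2) ht).const_mul (t ^ j))
    (fun _ hσ => (scaleKernel_mul_pow t hσ j).symm) measurableSet_Ioi

/-- The integrand over the scale parameters `σ = (σ₁, σ₂)` that remains once the means are
integrated out: two scale kernels coupled by a cross term with correlation `c`. -/
noncomputable def scaleIntegrand (a b t1 t2 c : ℝ) (σ : ℝ × ℝ) : ℝ :=
  scaleKernel a t1 σ.1 * scaleKernel b t2 σ.2 * Real.exp (2 * c * (t1 / σ.1 * (t2 / σ.2)))

theorem scaleIntegrand_nonneg {a b t1 t2 c : ℝ} {σ : ℝ × ℝ}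
    (hσ : σ ∈ Ioi (0 : ℝ) ×ˢ Ioi (0 : ℝ)) : 0 ≤ scaleIntegrand a b t1 t2 c σ :=
  mul_nonneg (mul_nonneg (scaleKernel_nonneg hσ.1) (scaleKernel_nonneg hσ.2)) (Real.exp_pos _).le

/-- The `j`th term of `scaleIntegrand` in the expansion of the exponential of the cross term. -/
noncomputable def scaleTerm (a b t1 t2 c : ℝ) (j : ℕ) (σ : ℝ × ℝ) : ℝ :=
  (2 * c) ^ j / j.factorial *
    ((scaleKernel a t1 σ.1 * (t1 / σ.1) ^ j) * (scaleKernel b t2 σ.2 * (t2 / σ.2) ^ j))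

theorem hasSum_scaleTerm (a b t1 t2 c : ℝ) (σ : ℝ × ℝ) :
    HasSum (fun j => scaleTerm a b t1 t2 c j σ) (scaleIntegrand a b t1 t2 c σ) := by
  have hexp := NormedSpace.expSeries_div_hasSum_exp (2 * c * (t1 / σ.1 * (t2 / σ.2)))
  rw [← Real.exp_eq_exp_ℝ] at hexp
  convert! hexp.mul_left (scaleKernel a t1 σ.1 * scaleKernel b t2 σ.2) using 2 with j
  rw [scaleTerm, mul_pow (2 * c), mul_pow (t1 / σ.1)]
  ring

variable {a b t1 t2 c : ℝ}

theorem integrableOn_scaleTerm (ha : 0 < a) (hb : 0 < b) (ht1 : 0 < t1) (ht2 : 0 < t2) (c : ℝ)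
    (j : ℕ) : IntegrableOn (scaleTerm a b t1 t2 c j) (Ioi 0 ×ˢ Ioi 0) := by
  rw [IntegrableOn, Measure.volume_eq_prod, ← Measure.prod_restrict]
  exact ((integrableOn_scaleKernel_mul_pow ha ht1 j).mul_prod
    (integrableOn_scaleKernel_mul_pow hb ht2 j)).const_mul _

theorem integral_scaleTerm (ha : 0 < a) (hb : 0 < b) (ht1 : 0 < t1) (ht2 : 0 < t2) (c : ℝ)
    (j : ℕ) : ∫ σ in Ioi (0 : ℝ) ×ˢ Ioi (0 : ℝ), scaleTerm a b t1 t2 c j σ =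
      t1 ^ (-2 * a) * t2 ^ (-2 * b) / 4 *
        ((2 * c) ^ j / j.factorial * (Real.Gamma (a + j / 2) * Real.Gamma (b + j / 2))) := by
  simp only [scaleTerm]
  rw [integral_const_mul, Measure.volume_eq_prod,
    setIntegral_prod_mul (fun σ => scaleKernel a t1 σ * (t1 / σ) ^ j)
      (fun σ => scaleKernel b t2 σ * (t2 / σ) ^ j),
    integral_scaleKernel_mul_pow ha ht1, integral_scaleKernel_mul_pow hb ht2]
  ring

theorem integral_norm_scaleTerm (a b c : ℝ) (ht1 : 0 < t1) (ht2 : 0 < t2) (j : ℕ) :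
    ∫ σ in Ioi (0 : ℝ) ×ˢ Ioi (0 : ℝ), ‖scaleTerm a b t1 t2 c j σ‖ =
      ∫ σ in Ioi (0 : ℝ) ×ˢ Ioi (0 : ℝ), scaleTerm a b t1 t2 |c| j σ := by
  refine setIntegral_congr_fun (measurableSet_Ioi.prod measurableSet_Ioi) fun σ hσ => ?_
  have hσ1 : 0 < σ.1 := hσ.1
  have hσ2 : 0 < σ.2 := hσ.2
  have := scaleKernel_nonneg (p := a) (t := t1) hσ1
  have := scaleKernel_nonneg (p := b) (t := t2) hσ2
  simp only [scaleTerm]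
  rw [norm_mul, Real.norm_of_nonneg (by positivity : 0 ≤ scaleKernel a t1 σ.1 * (t1 / σ.1) ^ j *
    (scaleKernel b t2 σ.2 * (t2 / σ.2) ^ j))]
  simp

theorem integral_scaleIntegrand (ha : 0 < a) (hb : 0 < b) (ht1 : 0 < t1) (ht2 : 0 < t2)
    (hc : |c| < 1) :
    ∫ σ in Ioi (0 : ℝ) ×ˢ Ioi (0 : ℝ), scaleIntegrand a b t1 t2 c σ =
      t1 ^ (-2 * a) * t2 ^ (-2 * b) / 4 * correlatedGamma a b c := by
  have hsummable : Summable fun j =>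
      ∫ σ in Ioi (0 : ℝ) ×ˢ Ioi (0 : ℝ), ‖scaleTerm a b t1 t2 c j σ‖ := by
    simp_rw [integral_norm_scaleTerm a b c ht1 ht2, integral_scaleTerm ha hb ht1 ht2]
    exact (hasSum_correlatedGamma ha hb (by rwa [abs_abs])).summable.mul_left _
  have h := hasSum_integral_of_summable_integral_norm
    (integrableOn_scaleTerm ha hb ht1 ht2 c) hsummable
  simp_rw [integral_scaleTerm ha hb ht1 ht2, (hasSum_scaleTerm a b t1 t2 c _).tsum_eq] at h
  exact h.unique ((hasSum_correlatedGamma ha hb hc).mul_left _)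

theorem integrableOn_scaleIntegrand (ha : 0 < a) (hb : 0 < b) (ht1 : 0 < t1) (ht2 : 0 < t2)
    (hc : |c| < 1) :
    IntegrableOn (scaleIntegrand a b t1 t2 c) (Ioi 0 ×ˢ Ioi 0) := by
  have habs : IntegrableOn (scaleIntegrand a b t1 t2 |c|) (Ioi 0 ×ˢ Ioi 0) :=
    .of_integral_ne_zero (by
      rw [integral_scaleIntegrand ha hb ht1 ht2 (by rwa [abs_abs])]
      have := correlatedGamma_pos ha hb (abs_nonneg c) hc
      positivity)
  refine habs.mono' (by unfold scaleIntegrand scaleKernel; fun_prop) ?_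
  refine ae_restrict_of_forall_mem (measurableSet_Ioi.prod measurableSet_Ioi) fun σ hσ => ?_
  rw [Real.norm_of_nonneg (scaleIntegrand_nonneg hσ), scaleIntegrand, scaleIntegrand]
  have hσ1 : 0 < σ.1 := hσ.1
  have hσ2 : 0 < σ.2 := hσ.2
  have := scaleKernel_nonneg (p := a) (t := t1) hσ1
  have := scaleKernel_nonneg (p := b) (t := t2) hσ2
  gcongr
  exact le_abs_self c

theorem correlatedGamma_nonneg (ha : 0 < a) (hb : 0 < b) (hc : |c| < 1) :
    0 ≤ correlatedGamma a b c := by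
  -- for `c < 0` the odd part is negative, so nonnegativity is read off the integral
  have h := setIntegral_nonneg (μ := volume) (measurableSet_Ioi.prod measurableSet_Ioi)
    fun _ hσ => scaleIntegrand_nonneg (a := a) (b := b) (t1 := 1) (t2 := 1) (c := c) hσ
  rw [integral_scaleIntegrand ha hb one_pos one_pos hc] at h
  norm_num at h
  linarith

end ScaleIntegral

section NuisanceIntegral

theorem lintegral_gaussian {A b : ℝ} (hA : 0 ≤ A) (hb : 0 < b) (d : ℝ) :
    ∫⁻ x, ENNReal.ofReal (A * Real.exp (-b * (x - d) ^ 2)) =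
      ENNReal.ofReal (A * √(Real.pi / b)) := by
  rw [← ofReal_integral_eq_lintegral_ofReal]
  · rw [integral_const_mul, integral_sub_right_eq_self (fun x => Real.exp (-b * x ^ 2)) d,
      integral_gaussian]
  · exact ((integrable_exp_neg_mul_sq hb).comp_sub_right d).const_mul A
  · exact ae_of_all _ fun x => by positivity

theorem lintegral_bivariate_gaussian {A κ σ1 σ2 ρ : ℝ} (hA : 0 ≤ A) (hκ : 0 < κ) (hσ1 : 0 < σ1)
    (hσ2 : 0 < σ2) (hρ : 0 < 1 - ρ ^ 2) (x1 x2 : ℝ) :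
    ∫⁻ μ2, ∫⁻ μ1, ENNReal.ofReal (A * Real.exp (-κ * ((x1 - μ1) ^ 2 / σ1 ^ 2
        - 2 * ρ * ((x1 - μ1) * (x2 - μ2) / (σ1 * σ2)) + (x2 - μ2) ^ 2 / σ2 ^ 2))) =
      ENNReal.ofReal (A * (Real.pi * σ1 * σ2 / (κ * √(1 - ρ ^ 2)))) := by
  have inner_integral (μ2 : ℝ) :
      ∫⁻ μ1, ENNReal.ofReal (A * Real.exp (-κ * ((x1 - μ1) ^ 2 / σ1 ^ 2
        - 2 * ρ * ((x1 - μ1) * (x2 - μ2) / (σ1 * σ2)) + (x2 - μ2) ^ 2 / σ2 ^ 2))) =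
      ENNReal.ofReal (A * √(Real.pi / (κ / σ1 ^ 2)) *
        Real.exp (-(κ * (1 - ρ ^ 2) / σ2 ^ 2) * (μ2 - x2) ^ 2)) := by
    -- the conditional mean of `μ1` given `μ2` completes the square
    rw [mul_right_comm A, ← lintegral_gaussian (by positivity) (by positivity)
      (x1 - ρ * σ1 * (x2 - μ2) / σ2)]
    refine lintegral_congr fun μ1 => ?_
    rw [mul_assoc A, ← Real.exp_add]
    congr 3
    field_simp
    ring
  have sqrt_arg : Real.pi / (κ / σ1 ^ 2) * (Real.pi / (κ * (1 - ρ ^ 2) / σ2 ^ 2)) =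
      (Real.pi * σ1 * σ2 / κ) ^ 2 / (1 - ρ ^ 2) := by
    field_simp
  simp_rw [inner_integral]
  rw [lintegral_gaussian (by positivity) (by positivity), mul_assoc,
    ← Real.sqrt_mul (by positivity), sqrt_arg, Real.sqrt_div (by positivity),
    Real.sqrt_sq (by positivity)]
  field_simp

/-- The closed form of `p_{γ,δ}(y₀)`. -/
noncomputable def nullConst (y : Summary) (γ δ : ℝ) : ℝ :=
  2 ^ ((-γ - δ - 4) / 2) * (Real.pi ^ (1 - (y.n : ℝ)) / y.n) *
    (y.n * y.s1 ^ 2) ^ ((1 + γ - y.n) / 2) * (y.n * y.s2 ^ 2) ^ ((1 + δ - y.n) / 2) *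
    Real.Gamma ((y.n - γ - 1) / 2) * Real.Gamma ((y.n - δ - 1) / 2)

theorem measurable_likelihood (y : Summary) :
    Measurable fun θ : Nuisance × ℝ => likelihood y θ.1 θ.2 := by
  unfold likelihood
  fun_prop

theorem measurable_priorNuisance (γ δ : ℝ) : Measurable (priorNuisance γ δ) := by
  unfold priorNuisance
  fun_prop

theorem measurable_likelihood_mul_priorNuisance (y : Summary) (γ δ ρ : ℝ) :
    Measurable fun θ₀ : Nuisance => likelihood y θ₀ ρ * priorNuisance γ δ θ₀ :=
  ((measurable_likelihood y).comp (by fun_prop : Measurable fun θ₀ : Nuisance => (θ₀, ρ))).mul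
    (measurable_priorNuisance γ δ)

theorem likelihood_mul_priorNuisance_nonneg (y : Summary) (γ δ ρ : ℝ) {θ₀ : Nuisance}
    (h : θ₀ ∈ nuisanceSet) : 0 ≤ likelihood y θ₀ ρ * priorNuisance γ δ θ₀ := by
  obtain ⟨μ1, μ2, σ1, σ2⟩ := θ₀
  have hσ1 : 0 < σ1 := h.2.2.1
  have hσ2 : 0 < σ2 := h.2.2.2
  simp only [likelihood, priorNuisance]
  positivity

theorem volume_restrict_nuisanceSet :
    (volume : Measure Nuisance).restrict nuisanceSet =
      (volume : Measure ℝ).prod ((volume : Measure ℝ).prod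
        ((volume : Measure (ℝ × ℝ)).restrict (Ioi 0 ×ˢ Ioi 0))) := by
  rw [nuisanceSet, Measure.volume_eq_prod, ← Measure.prod_restrict, Measure.restrict_univ,
    Measure.volume_eq_prod, ← Measure.prod_restrict, Measure.restrict_univ]

theorem scaleIntegrand_sqrt_mul (a b s1 s2 c : ℝ) {κ : ℝ} (hκ : 0 ≤ κ) (σ : ℝ × ℝ) :
    scaleIntegrand a b (√κ * s1) (√κ * s2) c σ =
      σ.1 ^ (-2 * a - 1) * σ.2 ^ (-2 * b - 1) * Real.exp (-κ *
        ((s1 / σ.1) ^ 2 - 2 * c * (s1 * s2 / (σ.1 * σ.2)) + (s2 / σ.2) ^ 2)) := by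
  have hexp : -κ * ((s1 / σ.1) ^ 2 - 2 * c * (s1 * s2 / (σ.1 * σ.2)) + (s2 / σ.2) ^ 2) =
      -(√κ * s1 / σ.1) ^ 2 + -(√κ * s2 / σ.2) ^ 2 +
        2 * c * (√κ * s1 / σ.1 * (√κ * s2 / σ.2)) := by
    nth_rewrite 1 [← Real.sq_sqrt hκ]
    ring
  rw [hexp, Real.exp_add, Real.exp_add, scaleIntegrand, scaleKernel, scaleKernel]
  ring

theorem rpow_neg_two_mul_half_sub_one {σ : ℝ} (hσ : 0 < σ) (n : ℕ) (γ : ℝ) :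
    σ ^ (-2 * ((n - γ - 1) / 2) - 1) = σ ^ (γ - 1) * σ / σ ^ n := by
  rw [show -2 * ((n - γ - 1) / 2) - 1 = (γ - 1) + 1 - (n : ℝ) by ring, Real.rpow_sub hσ,
    Real.rpow_add hσ, Real.rpow_one, Real.rpow_natCast]

theorem likelihood_prefactor_mul_gaussian_mass {n : ℕ} {σ1 σ2 ρ : ℝ} (γ δ : ℝ) (hn : 0 < n)
    (hσ1 : 0 < σ1) (hσ2 : 0 < σ2) (hρ : 0 < 1 - ρ ^ 2) :
    ((2 * Real.pi * σ1 * σ2 * √(1 - ρ ^ 2)) ^ n)⁻¹ * (σ1 ^ (γ - 1) * σ2 ^ (δ - 1)) *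
        (Real.pi * σ1 * σ2 / (n / (2 * (1 - ρ ^ 2)) * √(1 - ρ ^ 2))) =
      (2 * Real.pi * √(1 - ρ ^ 2)) ^ (1 - (n : ℝ)) / n *
        (σ1 ^ (-2 * ((n - γ - 1) / 2) - 1) * σ2 ^ (-2 * ((n - δ - 1) / 2) - 1)) := by
  have hsqrt : 0 < √(1 - ρ ^ 2) := Real.sqrt_pos.2 hρ
  have hsq : √(1 - ρ ^ 2) * √(1 - ρ ^ 2) = 1 - ρ ^ 2 := Real.mul_self_sqrt hρ.le
  set s := √(1 - ρ ^ 2)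
  rw [← hsq, rpow_neg_two_mul_half_sub_one hσ1, rpow_neg_two_mul_half_sub_one hσ2,
    Real.rpow_sub (x := 2 * Real.pi * s) (by positivity), Real.rpow_one, Real.rpow_natCast]
  simp only [mul_pow]
  field_simp

theorem lintegral_means (y : Summary) (γ δ : ℝ) {ρ : ℝ} (hn : 0 < y.n) (hρ : 0 < 1 - ρ ^ 2)
    {σ : ℝ × ℝ} (hσ : σ ∈ Ioi (0 : ℝ) ×ˢ Ioi (0 : ℝ)) :
    ∫⁻ μ2 : ℝ, ∫⁻ μ1 : ℝ,
        ENNReal.ofReal (likelihood y (μ1, μ2, σ) ρ * priorNuisance γ δ (μ1, μ2, σ)) =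
      ENNReal.ofReal ((2 * Real.pi * √(1 - ρ ^ 2)) ^ (1 - (y.n : ℝ)) / y.n *
        scaleIntegrand ((y.n - γ - 1) / 2) ((y.n - δ - 1) / 2)
          (√(y.n / (2 * (1 - ρ ^ 2))) * y.s1) (√(y.n / (2 * (1 - ρ ^ 2))) * y.s2)
          (y.r * ρ) σ) := by
  obtain ⟨σ1, σ2⟩ := σ
  obtain ⟨hσ1 : 0 < σ1, hσ2 : 0 < σ2⟩ := hσ
  set E := Real.exp (-(y.n / (2 * (1 - ρ ^ 2))) * ((y.s1 / σ1) ^ 2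
    - 2 * ρ * (y.r * y.s1 * y.s2 / (σ1 * σ2)) + (y.s2 / σ2) ^ 2)) with hE
  set A := ((2 * Real.pi * σ1 * σ2 * √(1 - ρ ^ 2)) ^ y.n)⁻¹ * (σ1 ^ (γ - 1) * σ2 ^ (δ - 1))
    with hA
  have gaussian := lintegral_bivariate_gaussian (A := A * E) (κ := y.n / (2 * (1 - ρ ^ 2)))
    (by positivity) (by positivity) hσ1 hσ2 hρ y.xbar1 y.xbar2
  rw [mul_right_comm A, hA, likelihood_prefactor_mul_gaussian_mass γ δ hn hσ1 hσ2 hρ, ← hA]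
    at gaussian
  rw [scaleIntegrand_sqrt_mul _ _ _ _ _ (by positivity), ← mul_assoc,
    show 2 * (y.r * ρ) * (y.s1 * y.s2 / (σ1 * σ2)) =
      2 * ρ * (y.r * y.s1 * y.s2 / (σ1 * σ2)) by ring, ← hE, ← gaussian]
  refine lintegral_congr fun μ2 => lintegral_congr fun μ1 => ?_
  simp only [likelihood, priorNuisance, ← hE, hA]
  congr 1
  ring

theorem one_sub_sq_rpow_mul_correlatedGamma {n : ℕ} {γ δ : ℝ} (r ρ : ℝ) (hγ : γ + 1 < n)
    (hδ : δ + 1 < n) :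
    (1 - ρ ^ 2) ^ ((n - γ - δ - 1) / 2) *
        correlatedGamma ((n - γ - 1) / 2) ((n - δ - 1) / 2) (r * ρ) =
      Real.Gamma ((n - γ - 1) / 2) * Real.Gamma ((n - δ - 1) / 2) *
        reducedLikelihood n r γ δ ρ := by
  have := Real.Gamma_pos_of_pos (by linarith : 0 < (n - γ - 1) / 2)
  have := Real.Gamma_pos_of_pos (by linarith : 0 < (n - δ - 1) / 2)
  rw [reducedLikelihood, partA, partB, correlatedGamma, ratioW,
    show (n - γ - 1) / 2 + 1 / 2 = (n - γ) / 2 by ring,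
    show (n - δ - 1) / 2 + 1 / 2 = (n - δ) / 2 by ring, mul_pow]
  field_simp

theorem sqrt_mul_rpow_neg_two_mul {κ s : ℝ} (hκ : 0 < κ) (hs : 0 < s) (a : ℝ) :
    (√κ * s) ^ (-2 * a) = (κ * s ^ 2) ^ (-a) := by
  rw [show κ * s ^ 2 = (√κ * s) ^ (2 : ℝ) by rw [Real.rpow_two, mul_pow, Real.sq_sqrt hκ.le],
    ← Real.rpow_mul (by positivity)]
  congr 1
  ring

theorem sqrt_div_two_mul_mul_rpow {n q s : ℝ} (hn : 0 < n) (hq : 0 < q) (hs : 0 < s) (a : ℝ) :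
    (√(n / (2 * q)) * s) ^ (-2 * a) = (n * s ^ 2) ^ (-a) * (2 ^ a * q ^ a) := by
  rw [sqrt_mul_rpow_neg_two_mul (by positivity) hs,
    show n / (2 * q) * s ^ 2 = n * s ^ 2 * (2 * q)⁻¹ by field_simp,
    Real.mul_rpow (by positivity) (by positivity), Real.inv_rpow (by positivity),
    ← Real.rpow_neg (by positivity), neg_neg, Real.mul_rpow two_pos.le hq.le]

theorem scale_constant_eq_nullConst_mul (y : Summary) (γ δ : ℝ) {q : ℝ} (hn : 0 < y.n)
    (hs1 : 0 < y.s1) (hs2 : 0 < y.s2) (hq : 0 < q) :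
    (2 * Real.pi * √q) ^ (1 - (y.n : ℝ)) / y.n *
        ((√(y.n / (2 * q)) * y.s1) ^ (-2 * ((y.n - γ - 1) / 2)) *
          (√(y.n / (2 * q)) * y.s2) ^ (-2 * ((y.n - δ - 1) / 2)) / 4) *
        (Real.Gamma ((y.n - γ - 1) / 2) * Real.Gamma ((y.n - δ - 1) / 2)) =
      nullConst y γ δ * q ^ ((y.n - γ - δ - 1) / 2) := by
  have hn' : (0 : ℝ) < y.n := by exact_mod_cast hn
  have two_powers : (2 : ℝ) ^ (1 - (y.n : ℝ)) * (2 ^ ((y.n - γ - 1) / 2) *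
      2 ^ ((y.n - δ - 1) / 2)) / 4 = 2 ^ ((-γ - δ - 4) / 2) := by
    rw [show (4 : ℝ) = 2 ^ (2 : ℝ) by norm_num, ← Real.rpow_add two_pos, ← Real.rpow_add two_pos,
      ← Real.rpow_sub two_pos]
    congr 1
    ring
  have q_powers : √q ^ (1 - (y.n : ℝ)) * (q ^ ((y.n - γ - 1) / 2) * q ^ ((y.n - δ - 1) / 2)) =
      q ^ ((y.n - γ - δ - 1) / 2) := by
    rw [Real.sqrt_eq_rpow, ← Real.rpow_mul hq.le, ← Real.rpow_add hq, ← Real.rpow_add hq]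
    congr 1
    ring
  rw [sqrt_div_two_mul_mul_rpow hn' hq hs1, sqrt_div_two_mul_mul_rpow hn' hq hs2,
    Real.mul_rpow (by positivity) (by positivity), Real.mul_rpow (by positivity) (by positivity),
    nullConst, ← two_powers, ← q_powers, show (1 + γ - y.n) / 2 = -((y.n - γ - 1) / 2) by ring,
    show (1 + δ - y.n) / 2 = -((y.n - δ - 1) / 2) by ring]
  ring

theorem abs_mul_lt_one {r ρ : ℝ} (hr : |r| < 1) (hρ : ρ ∈ Ioo (-1 : ℝ) 1) : |r * ρ| < 1 := by
  rw [abs_mul]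
  exact (mul_le_of_le_one_right (abs_nonneg r) (abs_lt.2 hρ).le).trans_lt hr

theorem reducedLikelihood_nonneg {n : ℕ} {r γ δ ρ : ℝ} (hr : |r| < 1) (hγ : γ + 1 < n)
    (hδ : δ + 1 < n) (hρ : ρ ∈ Ioo (-1 : ℝ) 1) : 0 ≤ reducedLikelihood n r γ δ ρ := by
  have ha : 0 < (n - γ - 1) / 2 := by linarith
  have hb : 0 < (n - δ - 1) / 2 := by linarith
  have := Real.Gamma_pos_of_pos ha
  have := Real.Gamma_pos_of_pos hb
  have h := mul_nonneg (Real.rpow_nonneg (one_sub_sq_pos hρ).le ((n - γ - δ - 1) / 2))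
    (correlatedGamma_nonneg ha hb (abs_mul_lt_one hr hρ))
  rw [one_sub_sq_rpow_mul_correlatedGamma r ρ hγ hδ] at h
  exact nonneg_of_mul_nonneg_right h (by positivity)

/-- The range `n ≥ 1`, `s₁, s₂ > 0`, `|r| < 1` of the summaries in the model. -/
structure Summary.IsValid (y : Summary) : Prop where
  n_pos : 0 < y.n
  s1_pos : 0 < y.s1
  s2_pos : 0 < y.s2
  abs_r_lt_one : |y.r| < 1

theorem nullConst_pos {y : Summary} (hn : 0 < y.n) (hs1 : 0 < y.s1) (hs2 : 0 < y.s2) {γ δ : ℝ}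
    (hγ : γ + 1 < y.n) (hδ : δ + 1 < y.n) : 0 < nullConst y γ δ := by
  have := Real.Gamma_pos_of_pos (by linarith : 0 < (y.n - γ - 1) / 2)
  have := Real.Gamma_pos_of_pos (by linarith : 0 < (y.n - δ - 1) / 2)
  unfold nullConst
  positivity

theorem lintegral_nuisance {y : Summary} (hy : y.IsValid) {γ δ ρ : ℝ} (hγ : γ + 1 < y.n)
    (hδ : δ + 1 < y.n) (hρ : ρ ∈ Ioo (-1 : ℝ) 1) :
    ∫⁻ θ₀ in nuisanceSet, ENNReal.ofReal (likelihood y θ₀ ρ * priorNuisance γ δ θ₀) =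
      ENNReal.ofReal (nullConst y γ δ * reducedLikelihood y.n y.r γ δ ρ) := by
  obtain ⟨hn, hs1, hs2, hr⟩ := hy
  have hρ' := one_sub_sq_pos hρ
  have ha : 0 < (y.n - γ - 1) / 2 := by linarith
  have hb : 0 < (y.n - δ - 1) / 2 := by linarith
  have ht1 : 0 < √(y.n / (2 * (1 - ρ ^ 2))) * y.s1 := by positivity
  have ht2 : 0 < √(y.n / (2 * (1 - ρ ^ 2))) * y.s2 := by positivity
  have hquadrant : MeasurableSet (Ioi (0 : ℝ) ×ˢ Ioi (0 : ℝ)) :=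
    measurableSet_Ioi.prod measurableSet_Ioi
  have hmeas := (measurable_likelihood_mul_priorNuisance y γ δ ρ).ennreal_ofReal
  rw [volume_restrict_nuisanceSet, lintegral_prod_symm _ hmeas.aemeasurable,
    lintegral_prod_symm _ hmeas.lintegral_prod_left'.aemeasurable,
    setLIntegral_congr_fun hquadrant fun σ hσ => lintegral_means y γ δ hn hρ' hσ,
    ← ofReal_integral_eq_lintegral_ofReal]
  · have := Real.Gamma_pos_of_pos ha
    have := Real.Gamma_pos_of_pos hb
    rw [integral_const_mul, integral_scaleIntegrand ha hb ht1 ht2 (abs_mul_lt_one hr hρ)]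
    congr 1
    refine mul_left_cancel₀ (by positivity : Real.Gamma ((y.n - γ - 1) / 2) *
      Real.Gamma ((y.n - δ - 1) / 2) ≠ 0) ?_
    linear_combination correlatedGamma ((y.n - γ - 1) / 2) ((y.n - δ - 1) / 2) (y.r * ρ) *
      scale_constant_eq_nullConst_mul y γ δ hn hs1 hs2 hρ' +
      nullConst y γ δ * one_sub_sq_rpow_mul_correlatedGamma y.r ρ hγ hδ
  · exact (integrableOn_scaleIntegrand ha hb ht1 ht2 (abs_mul_lt_one hr hρ)).const_mul _
  · exact ae_restrict_of_forall_mem hquadrant fun σ hσ =>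
      mul_nonneg (by positivity) (scaleIntegrand_nonneg hσ)

end NuisanceIntegral

section PriorIntegral

theorem rpow_mul_priorRho (C α β u : ℝ) {ρ : ℝ} (hρ : ρ ∈ Ioo (-1 : ℝ) 1) :
    (1 - ρ ^ 2) ^ u * priorRho C α β ρ = C⁻¹ * rhoWeight (α + u) β ρ := by
  rw [priorRho, rhoWeight, show α + u - 1 = u + (α - 1) by ring,
    Real.rpow_add (one_sub_sq_pos hρ)]
  ring

theorem priorRho_pos {C α β ρ : ℝ} (hC : 0 < C) (hρ : ρ ∈ Ioo (-1 : ℝ) 1) :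
    0 < priorRho C α β ρ :=
  div_pos (rhoWeight_pos hρ) hC

theorem priorConst_eq_eulerValue (α β : ℝ) : priorConst α β = eulerValue β α (1 / 2) := by
  rw [priorConst, eulerValue, add_comm α]

theorem priorConst_pos {α : ℝ} (β : ℝ) (hα : 0 < α) : 0 < priorConst α β :=
  (priorConst_eq_eulerValue α β).symm ▸ eulerValue_pos β hα one_half_pos

theorem integral_priorRho_priorConst {α : ℝ} (β : ℝ) (hα : 0 < α) :
    ∫ ρ in (-1 : ℝ)..1, priorRho (priorConst α β) α β ρ = 1 :=
  calc ∫ ρ in (-1 : ℝ)..1, priorRho (priorConst α β) α β ρ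
      = (∫ ρ in (-1 : ℝ)..1, rhoWeight α β ρ) / priorConst α β :=
        intervalIntegral.integral_div _ _
    _ = 1 := by
      rw [integral_rhoWeight β hα, ← priorConst_eq_eulerValue, div_self (priorConst_pos β hα).ne']

theorem pow_mul_partA_mul_priorRho (n : ℕ) (r C α β γ δ : ℝ) (k : ℕ) {ρ : ℝ}
    (hρ : ρ ∈ Ioo (-1 : ℝ) 1) :
    ρ ^ k * partA n r γ δ ρ * priorRho C α β ρ = C⁻¹ *
      (ρ ^ k * gauss2F1 ((n - γ - 1) / 2) ((n - δ - 1) / 2) (1 / 2) (r ^ 2 * ρ ^ 2) *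
        rhoWeight (α + (n - γ - δ - 1) / 2) β ρ) := by
  rw [partA]
  linear_combination (ρ ^ k * gauss2F1 ((n - γ - 1) / 2) ((n - δ - 1) / 2) (1 / 2)
    (r ^ 2 * ρ ^ 2)) * rpow_mul_priorRho C α β ((n - γ - δ - 1) / 2) hρ

theorem pow_mul_partB_mul_priorRho (n : ℕ) (r C α β γ δ : ℝ) (k : ℕ) {ρ : ℝ}
    (hρ : ρ ∈ Ioo (-1 : ℝ) 1) :
    ρ ^ k * partB n r γ δ ρ * priorRho C α β ρ = 2 * ratioW n γ δ * C⁻¹ * r *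
      (ρ ^ (k + 1) * gauss2F1 ((n - γ) / 2) ((n - δ) / 2) (3 / 2) (r ^ 2 * ρ ^ 2) *
        rhoWeight (α + (n - γ - δ - 1) / 2) β ρ) := by
  rw [partB]
  linear_combination (2 * r * ratioW n γ δ * ρ ^ (k + 1) *
    gauss2F1 ((n - γ) / 2) ((n - δ) / 2) (3 / 2) (r ^ 2 * ρ ^ 2)) *
    rpow_mul_priorRho C α β ((n - γ - δ - 1) / 2) hρ

theorem partA_pos {n : ℕ} {r γ δ ρ : ℝ} (hr : |r| < 1) (hγ : γ + 1 < n) (hδ : δ + 1 < n)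
    (hρ : ρ ∈ Ioo (-1 : ℝ) 1) : 0 < partA n r γ δ ρ := by
  have hF := one_le_gauss2F1 (by linarith : 0 < (n - γ - 1) / 2)
    (by linarith : 0 < (n - δ - 1) / 2) (one_half_pos (α := ℝ))
    (by positivity : 0 ≤ r ^ 2 * ρ ^ 2)
    ((le_abs_self _).trans_lt (abs_sq_mul_sq_lt_one hr (Ioo_subset_Icc_self hρ)))
  exact mul_pos (Real.rpow_pos_of_pos (one_sub_sq_pos hρ) _) (one_pos.trans_le hF)

theorem ratioW_pos {n : ℕ} {γ δ : ℝ} (hγ : γ + 1 < n) (hδ : δ + 1 < n) : 0 < ratioW n γ δ := by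
  have := Real.Gamma_pos_of_pos (by linarith : 0 < (n - γ) / 2)
  have := Real.Gamma_pos_of_pos (by linarith : 0 < (n - δ) / 2)
  have := Real.Gamma_pos_of_pos (by linarith : 0 < (n - γ - 1) / 2)
  have := Real.Gamma_pos_of_pos (by linarith : 0 < (n - δ - 1) / 2)
  unfold ratioW
  positivity

theorem reducedLikelihood_zero (n : ℕ) (r γ δ : ℝ) : reducedLikelihood n r γ δ 0 = 1 := by
  have h := gauss2F1_eq_ordinaryHypergeometric ((n - γ - 1) / 2) ((n - δ - 1) / 2)
    (one_half_pos (α := ℝ)) (by simp : |(0 : ℝ)| < 1)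
  rw [ordinaryHypergeometric_zero] at h
  simpa [reducedLikelihood, partA, partB] using h

theorem integral_pow_mul_partA_of_odd (n : ℕ) (r C α β γ δ : ℝ) {k : ℕ} (hk : Odd k) :
    ∫ ρ in (-1 : ℝ)..1, ρ ^ k * partA n r γ δ ρ * priorRho C α β ρ = 0 :=
  integral_eq_zero_of_odd (fun ρ => by simp [partA, priorRho, hk.neg_pow]) 1

theorem integral_pow_mul_partB_of_even (n : ℕ) (r C α β γ δ : ℝ) {k : ℕ} (hk : Even k) :
    ∫ ρ in (-1 : ℝ)..1, ρ ^ k * partB n r γ δ ρ * priorRho C α β ρ = 0 :=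
  integral_eq_zero_of_odd (fun ρ => by simp [partB, priorRho, hk.neg_pow]) 1

theorem integral_partB (n : ℕ) (r C α β γ δ : ℝ) :
    ∫ ρ in (-1 : ℝ)..1, partB n r γ δ ρ * priorRho C α β ρ = 0 := by
  simpa using integral_pow_mul_partB_of_even n r C α β γ δ Even.zero

section Integrable

variable {n : ℕ} {r α γ δ : ℝ} (C β : ℝ) (hr : |r| < 1) (hη : γ + δ - 2 * α + 1 < n)

include hr hη

theorem intervalIntegrable_pow_mul_partA (k : ℕ) :
    IntervalIntegrable (fun ρ => ρ ^ k * partA n r γ δ ρ * priorRho C α β ρ) volume (-1) 1 := by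
  refine ((intervalIntegrable_mul_gauss2F1_mul_rhoWeight ((n - γ - 1) / 2) ((n - δ - 1) / 2) β
    one_half_pos (by linarith : 0 < α + (n - γ - δ - 1) / 2) hr
    (continuous_pow k)).const_mul C⁻¹).congr_uIoo fun ρ hρ => ?_
  rw [uIoo_of_le (by norm_num)] at hρ
  exact (pow_mul_partA_mul_priorRho n r C α β γ δ k hρ).symm

theorem intervalIntegrable_pow_mul_partB (k : ℕ) :
    IntervalIntegrable (fun ρ => ρ ^ k * partB n r γ δ ρ * priorRho C α β ρ) volume (-1) 1 := by
  refine ((intervalIntegrable_mul_gauss2F1_mul_rhoWeight ((n - γ) / 2) ((n - δ) / 2) β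
    (by norm_num : (0 : ℝ) < 3 / 2) (by linarith : 0 < α + (n - γ - δ - 1) / 2) hr
    (continuous_pow (k + 1))).const_mul (2 * ratioW n γ δ * C⁻¹ * r)).congr_uIoo fun ρ hρ => ?_
  rw [uIoo_of_le (by norm_num)] at hρ
  exact (pow_mul_partB_mul_priorRho n r C α β γ δ k hρ).symm

theorem intervalIntegrable_partA :
    IntervalIntegrable (fun ρ => partA n r γ δ ρ * priorRho C α β ρ) volume (-1) 1 := by
  simpa using intervalIntegrable_pow_mul_partA C β hr hη 0

theorem intervalIntegrable_partB :
    IntervalIntegrable (fun ρ => partB n r γ δ ρ * priorRho C α β ρ) volume (-1) 1 := by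
  simpa using intervalIntegrable_pow_mul_partB C β hr hη 0

theorem integrableOn_reducedLikelihood :
    IntegrableOn (fun ρ => reducedLikelihood n r γ δ ρ * priorRho C α β ρ) (Ioo (-1) 1) := by
  rw [← intervalIntegrable_iff_integrableOn_Ioo_of_le (by norm_num)]
  simpa only [reducedLikelihood, add_mul] using!
    (intervalIntegrable_partA C β hr hη).add (intervalIntegrable_partB C β hr hη)

theorem normConst_eq_integral_partA :
    normConst n r C α β γ δ = ∫ ρ in (-1 : ℝ)..1, partA n r γ δ ρ * priorRho C α β ρ := by
  simp only [normConst, reducedLikelihood, add_mul]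
  rw [intervalIntegral.integral_add (intervalIntegrable_partA C β hr hη)
    (intervalIntegrable_partB C β hr hη), integral_partB, add_zero]

end Integrable

theorem normConst_pos {n : ℕ} {r α γ δ C : ℝ} (β : ℝ) (hr : |r| < 1) (hγ : γ + 1 < n)
    (hδ : δ + 1 < n) (hη : γ + δ - 2 * α + 1 < n) (hC : 0 < C) :
    0 < normConst n r C α β γ δ := by
  rw [normConst_eq_integral_partA C β hr hη]
  exact intervalIntegral.intervalIntegral_pos_of_pos_on (intervalIntegrable_partA C β hr hη)
    (fun ρ hρ => mul_pos (partA_pos hr hγ hδ hρ) (priorRho_pos hC hρ)) (by norm_num)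

theorem evenCoeff_eq (n : ℕ) (α β γ δ : ℝ) (k m : ℕ) :
    evenCoeff n α β γ δ k m = gaussCoeff ((n - γ - 1) / 2) ((n - δ - 1) / 2) (1 / 2) m *
      eulerValue β (α + (n - γ - δ - 1) / 2) ((k + 1) / 2 + m) := by
  rw [evenCoeff, coeffa, gaussCoeff, eulerValue,
    show (1 : ℝ) / 2 + (k + 2 * m) / 2 = (k + 1) / 2 + m by ring,
    show ((k : ℝ) + 2 * m + 1) / 2 = (k + 1) / 2 + m by ring,
    show ((k : ℝ) + 2 * m + 2 * α + n - γ - δ) / 2 =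
      (k + 1) / 2 + m + (α + (n - γ - δ - 1) / 2) by ring]

theorem oddCoeff_eq (n : ℕ) (α β γ δ : ℝ) (k m : ℕ) :
    oddCoeff n α β γ δ k m = gaussCoeff ((n - γ) / 2) ((n - δ) / 2) (3 / 2) m *
      eulerValue β (α + (n - γ - δ - 1) / 2) ((k + 2) / 2 + m) := by
  rw [oddCoeff, coeffb, gaussCoeff, eulerValue,
    show (1 : ℝ) / 2 + (k + 2 * m + 1) / 2 = (k + 2) / 2 + m by ring,
    show ((k : ℝ) + 2 * m + 2) / 2 = (k + 2) / 2 + m by ring,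
    show ((k : ℝ) + 2 * m + 2 * α + n - γ - δ + 1) / 2 =
      (k + 2) / 2 + m + (α + (n - γ - δ - 1) / 2) by ring]

section MomentSeries

variable {n : ℕ} {r α γ δ C : ℝ} (β : ℝ)

theorem hasSum_evenCoeff (hr : |r| < 1) (hη : γ + δ - 2 * α + 1 < n) (hC : C ≠ 0) {k : ℕ}
    (hk : Even k) :
    HasSum (fun m => evenCoeff n α β γ δ k m * r ^ (2 * m))
      (C * ∫ ρ in (-1 : ℝ)..1, ρ ^ k * partA n r γ δ ρ * priorRho C α β ρ) := by
  obtain ⟨l, rfl⟩ := hk.two_dvd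
  have hterm (m : ℕ) : (((2 * l : ℕ) : ℝ) + 1) / 2 + m = l + 1 / 2 + m := by
    push_cast
    ring
  rw [intervalIntegral.integral_congr_Ioo_of_le (by norm_num)
      (fun ρ hρ => pow_mul_partA_mul_priorRho n r C α β γ δ (2 * l) hρ),
    intervalIntegral.integral_const_mul, mul_inv_cancel_left₀ hC]
  simp only [evenCoeff_eq, hterm]
  exact hasSum_integral_pow_mul_gauss2F1_mul_rhoWeight _ _ β one_half_pos (by linarith) hr l

theorem hasSum_oddCoeff (hr : |r| < 1) (hγ : γ + 1 < n) (hδ : δ + 1 < n)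
    (hη : γ + δ - 2 * α + 1 < n) (hC : C ≠ 0) {k : ℕ} (hk : Odd k) :
    HasSum (fun m => oddCoeff n α β γ δ k m * r ^ (2 * m + 1))
      (C / (2 * ratioW n γ δ) *
        ∫ ρ in (-1 : ℝ)..1, ρ ^ k * partB n r γ δ ρ * priorRho C α β ρ) := by
  obtain ⟨l, rfl⟩ := hk
  have hW := ratioW_pos hγ hδ
  have hterm (m : ℕ) : (((2 * l + 1 : ℕ) : ℝ) + 2) / 2 + m = (l + 1 : ℕ) + 1 / 2 + m := by
    push_cast
    ring
  have h := (hasSum_integral_pow_mul_gauss2F1_mul_rhoWeight ((n - γ) / 2) ((n - δ) / 2) β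
    (by norm_num : (0 : ℝ) < 3 / 2) (by linarith : 0 < α + (n - γ - δ - 1) / 2) hr
    (l + 1)).mul_right r
  rw [intervalIntegral.integral_congr_Ioo_of_le (by norm_num)
      (fun ρ hρ => pow_mul_partB_mul_priorRho n r C α β γ δ (2 * l + 1) hρ),
    intervalIntegral.integral_const_mul]
  simp only [oddCoeff_eq, hterm, pow_succ r, ← mul_assoc _ _ r]
  convert! h using 1
  rw [show 2 * l + 1 + 1 = 2 * (l + 1) by ring]
  field_simp

theorem isHypergeometricSeq_evenCoeff (hη : γ + δ - 2 * α + 1 < n) (j k : ℕ) :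
    IsHypergeometricSeq (evenCoeff n α (2 * j) γ δ k) := by
  rw [funext (evenCoeff_eq n α (2 * j) γ δ k)]
  exact (isHypergeometricSeq_gaussCoeff _ _ one_half_pos).mul
    (isHypergeometricSeq_eulerValue (by positivity) (by linarith) j)

theorem isHypergeometricSeq_oddCoeff (hη : γ + δ - 2 * α + 1 < n) (j k : ℕ) :
    IsHypergeometricSeq (oddCoeff n α (2 * j) γ δ k) := by
  rw [funext (oddCoeff_eq n α (2 * j) γ δ k)]
  exact (isHypergeometricSeq_gaussCoeff _ _ (by norm_num)).mul
    (isHypergeometricSeq_eulerValue (by positivity) (by linarith) j)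

end MomentSeries

end PriorIntegral

section Posterior

theorem integrable_of_lintegral_ofReal_eq {X : Type*} [MeasurableSpace X] {μ : Measure X}
    {f : X → ℝ} {I : ℝ} (hf : AEStronglyMeasurable f μ) (hf0 : 0 ≤ᵐ[μ] f)
    (h : ∫⁻ x, ENNReal.ofReal (f x) ∂μ = ENNReal.ofReal I) : Integrable f μ :=
  (lintegral_ofReal_ne_top_iff_integrable hf hf0).1 (h ▸ ENNReal.ofReal_ne_top)

theorem integral_eq_of_lintegral_ofReal_eq {X : Type*} [MeasurableSpace X] {μ : Measure X}
    {f : X → ℝ} {I : ℝ} (hf : AEStronglyMeasurable f μ) (hf0 : 0 ≤ᵐ[μ] f) (hI : 0 ≤ I)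
    (h : ∫⁻ x, ENNReal.ofReal (f x) ∂μ = ENNReal.ofReal I) : ∫ x, f x ∂μ = I := by
  rw [integral_eq_lintegral_of_nonneg_ae hf0 hf, h, ENNReal.toReal_ofReal hI]

theorem map_snd_withDensity_prod {X Y : Type*} [MeasurableSpace X] [MeasurableSpace Y]
    (μ : Measure X) (ν : Measure Y) [SFinite μ] [SFinite ν] {f : X × Y → ENNReal}
    (hf : Measurable f) :
    ((μ.prod ν).withDensity f).map Prod.snd = ν.withDensity fun y => ∫⁻ x, f (x, y) ∂μ := by
  ext S hS
  rw [Measure.map_apply measurable_snd hS, withDensity_apply _ (measurable_snd hS),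
    withDensity_apply _ hS, ← univ_prod, ← Measure.prod_restrict, Measure.restrict_univ,
    lintegral_prod_symm _ hf.aemeasurable]

theorem setIntegral_Ioo_eq_intervalIntegral (f : ℝ → ℝ) {a b : ℝ} (hab : a ≤ b) :
    ∫ x in Ioo a b, f x = ∫ x in a..b, f x := by
  rw [intervalIntegral.integral_of_le hab, integral_Ioc_eq_integral_Ioo]

theorem measurableSet_nuisanceSet : MeasurableSet nuisanceSet :=
  MeasurableSet.univ.prod (MeasurableSet.univ.prod (measurableSet_Ioi.prod measurableSet_Ioi))

theorem measurableSet_paramSet : MeasurableSet paramSet :=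
  measurableSet_nuisanceSet.prod measurableSet_Ioo

theorem volume_restrict_paramSet :
    (volume : Measure (Nuisance × ℝ)).restrict paramSet =
      ((volume : Measure Nuisance).restrict nuisanceSet).prod (volume.restrict (Ioo (-1) 1)) := by
  rw [paramSet, Measure.volume_eq_prod, Measure.prod_restrict]

theorem likelihood_mul_priorNuisance_nonneg_ae (y : Summary) (γ δ ρ : ℝ) :
    0 ≤ᵐ[volume.restrict nuisanceSet] fun θ₀ => likelihood y θ₀ ρ * priorNuisance γ δ θ₀ :=
  ae_restrict_of_forall_mem measurableSet_nuisanceSet fun _ hθ₀ =>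
    likelihood_mul_priorNuisance_nonneg y γ δ ρ hθ₀

theorem measurable_joint (y : Summary) (C α β γ δ : ℝ) : Measurable (joint y C α β γ δ) := by
  have hprior : Measurable (priorRho C α β) := by
    unfold priorRho
    fun_prop
  exact (measurable_likelihood y).mul
    ((hprior.comp measurable_snd).mul ((measurable_priorNuisance γ δ).comp measurable_fst))

theorem joint_nonneg_ae (y : Summary) {C : ℝ} (α β γ δ : ℝ) (hC : 0 < C) :
    0 ≤ᵐ[volume.restrict paramSet] joint y C α β γ δ := by
  refine ae_restrict_of_forall_mem measurableSet_paramSet fun θ hθ => ?_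
  rw [Pi.zero_apply, joint, mul_left_comm]
  exact mul_nonneg (priorRho_pos hC hθ.2).le
    (likelihood_mul_priorNuisance_nonneg y γ δ θ.2 hθ.1)

variable {y : Summary} {α γ δ C : ℝ} (β : ℝ)

section NullModel

variable (hy : y.IsValid) (hγ : γ + 1 < y.n) (hδ : δ + 1 < y.n)

include hy hγ hδ

theorem lintegral_nuisance_zero :
    ∫⁻ θ₀ in nuisanceSet, ENNReal.ofReal (likelihood y θ₀ 0 * priorNuisance γ δ θ₀) =
      ENNReal.ofReal (nullConst y γ δ) := by
  rw [lintegral_nuisance hy hγ hδ (by simp), reducedLikelihood_zero, mul_one]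

theorem integrableOn_likelihood_zero_mul_priorNuisance :
    IntegrableOn (fun θ₀ => likelihood y θ₀ 0 * priorNuisance γ δ θ₀) nuisanceSet :=
  integrable_of_lintegral_ofReal_eq
    (measurable_likelihood_mul_priorNuisance y γ δ 0).aestronglyMeasurable
    (likelihood_mul_priorNuisance_nonneg_ae y γ δ 0) (lintegral_nuisance_zero hy hγ hδ)

theorem nullMarginalLikelihood_eq : nullMarginalLikelihood y γ δ = nullConst y γ δ :=
  integral_eq_of_lintegral_ofReal_eq
    (measurable_likelihood_mul_priorNuisance y γ δ 0).aestronglyMeasurable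
    (likelihood_mul_priorNuisance_nonneg_ae y γ δ 0)
    (nullConst_pos hy.n_pos hy.s1_pos hy.s2_pos hγ hδ).le (lintegral_nuisance_zero hy hγ hδ)

theorem lintegral_nuisance_joint (hC : 0 < C) {ρ : ℝ} (hρ : ρ ∈ Ioo (-1 : ℝ) 1) :
    ∫⁻ θ₀ in nuisanceSet, ENNReal.ofReal (joint y C α β γ δ (θ₀, ρ)) =
      ENNReal.ofReal
        (nullConst y γ δ * (reducedLikelihood y.n y.r γ δ ρ * priorRho C α β ρ)) := by
  have hπ : 0 ≤ priorRho C α β ρ := (priorRho_pos hC hρ).le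
  simp_rw [joint, mul_left_comm _ (priorRho C α β ρ), ENNReal.ofReal_mul hπ]
  rw [lintegral_const_mul _ (measurable_likelihood_mul_priorNuisance y γ δ ρ).ennreal_ofReal,
    lintegral_nuisance hy hγ hδ hρ, ← ENNReal.ofReal_mul hπ]
  congr 1
  ring

theorem reducedLikelihood_mul_priorRho_nonneg_ae (hC : 0 < C) :
    0 ≤ᵐ[volume.restrict (Ioo (-1) 1)]
      fun ρ => reducedLikelihood y.n y.r γ δ ρ * priorRho C α β ρ :=
  ae_restrict_of_forall_mem measurableSet_Ioo fun _ hρ =>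
    mul_nonneg (reducedLikelihood_nonneg hy.abs_r_lt_one hγ hδ hρ) (priorRho_pos hC hρ).le

end NullModel

section FullModel

variable (hy : y.IsValid) (hγ : γ + 1 < y.n) (hδ : δ + 1 < y.n) (hη : γ + δ - 2 * α + 1 < y.n)
  (hC : 0 < C)

include hy hγ hδ hη hC

theorem lintegral_joint :
    ∫⁻ θ in paramSet, ENNReal.ofReal (joint y C α β γ δ θ) =
      ENNReal.ofReal (nullConst y γ δ * normConst y.n y.r C α β γ δ) := by
  have hK := (nullConst_pos hy.n_pos hy.s1_pos hy.s2_pos hγ hδ).le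
  rw [volume_restrict_paramSet,
    lintegral_prod_symm _ (measurable_joint y C α β γ δ).ennreal_ofReal.aemeasurable,
    setLIntegral_congr_fun measurableSet_Ioo fun ρ hρ =>
      lintegral_nuisance_joint β hy hγ hδ hC hρ]
  simp_rw [ENNReal.ofReal_mul hK]
  rw [lintegral_const_mul' _ _ ENNReal.ofReal_ne_top, ← ofReal_integral_eq_lintegral_ofReal
      (integrableOn_reducedLikelihood C β hy.abs_r_lt_one hη)
      (reducedLikelihood_mul_priorRho_nonneg_ae β hy hγ hδ hC),
    setIntegral_Ioo_eq_intervalIntegral _ (by norm_num), normConst]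

theorem integrableOn_joint : IntegrableOn (joint y C α β γ δ) paramSet :=
  integrable_of_lintegral_ofReal_eq (measurable_joint y C α β γ δ).aestronglyMeasurable
    (joint_nonneg_ae y α β γ δ hC) (lintegral_joint β hy hγ hδ hη hC)

theorem marginalLikelihood_eq :
    marginalLikelihood y C α β γ δ = nullConst y γ δ * normConst y.n y.r C α β γ δ :=
  integral_eq_of_lintegral_ofReal_eq (measurable_joint y C α β γ δ).aestronglyMeasurable
    (joint_nonneg_ae y α β γ δ hC)
    (mul_nonneg (nullConst_pos hy.n_pos hy.s1_pos hy.s2_pos hγ hδ).le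
      (normConst_pos β hy.abs_r_lt_one hγ hδ hη hC).le)
    (lintegral_joint β hy hγ hδ hη hC)

theorem marginalPosterior_eq_withDensity :
    marginalPosterior y C α β γ δ =
      (volume.restrict (Ioo (-1) 1)).withDensity (fun ρ => ENNReal.ofReal
        (reducedLikelihood y.n y.r γ δ ρ * priorRho C α β ρ / normConst y.n y.r C α β γ δ)) := by
  have hK := nullConst_pos hy.n_pos hy.s1_pos hy.s2_pos hγ hδ
  have hp := normConst_pos β hy.abs_r_lt_one hγ hδ hη hC
  rw [marginalPosterior, posterior, volume_restrict_paramSet, map_snd_withDensity_prod _ _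
    ((measurable_joint y C α β γ δ).div_const _).ennreal_ofReal]
  refine withDensity_congr_ae (ae_restrict_of_forall_mem measurableSet_Ioo fun ρ hρ => ?_)
  simp_rw [marginalLikelihood_eq β hy hγ hδ hη hC, ENNReal.ofReal_div_of_pos (mul_pos hK hp),
    div_eq_mul_inv]
  rw [lintegral_mul_const' _ _ (by simpa using mul_pos hK hp),
    lintegral_nuisance_joint β hy hγ hδ hC hρ, ← div_eq_mul_inv,
    ← ENNReal.ofReal_div_of_pos (mul_pos hK hp), mul_div_mul_left _ _ hK.ne', div_eq_mul_inv]

theorem posteriorDensity_nonneg_ae :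
    0 ≤ᵐ[volume.restrict (Ioo (-1) 1)] fun ρ =>
      reducedLikelihood y.n y.r γ δ ρ * priorRho C α β ρ / normConst y.n y.r C α β γ δ :=
  (reducedLikelihood_mul_priorRho_nonneg_ae β hy hγ hδ hC).mono fun _ h =>
    div_nonneg h (normConst_pos β hy.abs_r_lt_one hγ hδ hη hC).le

theorem isProbabilityMeasure_marginalPosterior :
    IsProbabilityMeasure (marginalPosterior y C α β γ δ) := by
  refine ⟨?_⟩
  rw [marginalPosterior_eq_withDensity β hy hγ hδ hη hC, withDensity_apply _ MeasurableSet.univ,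
    Measure.restrict_univ, ← ofReal_integral_eq_lintegral_ofReal
      ((integrableOn_reducedLikelihood C β hy.abs_r_lt_one hη).div_const _)
      (posteriorDensity_nonneg_ae β hy hγ hδ hη hC), integral_div,
    setIntegral_Ioo_eq_intervalIntegral _ (by norm_num), ← normConst,
    div_self (normConst_pos β hy.abs_r_lt_one hγ hδ hη hC).ne', ENNReal.ofReal_one]

theorem integrable_pow_marginalPosterior (k : ℕ) :
    Integrable (fun ρ : ℝ => ρ ^ k) (marginalPosterior y C α β γ δ) := by
  have := isProbabilityMeasure_marginalPosterior β hy hγ hδ hη hC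
  refine Integrable.of_bound (by fun_prop) 1 ?_
  rw [marginalPosterior_eq_withDensity β hy hγ hδ hη hC]
  refine (withDensity_absolutelyContinuous _ _).ae_le
    (ae_restrict_of_forall_mem measurableSet_Ioo fun ρ hρ => ?_)
  rw [norm_pow]
  exact pow_le_one₀ (norm_nonneg ρ) (abs_lt.2 hρ).le

theorem posteriorMoment_eq (k : ℕ) :
    posteriorMoment y C α β γ δ k = 1 / normConst y.n y.r C α β γ δ *
      ((∫ ρ in (-1 : ℝ)..1, ρ ^ k * partA y.n y.r γ δ ρ * priorRho C α β ρ) +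
        ∫ ρ in (-1 : ℝ)..1, ρ ^ k * partB y.n y.r γ δ ρ * priorRho C α β ρ) := by
  have hr := hy.abs_r_lt_one
  rw [posteriorMoment, marginalPosterior_eq_withDensity β hy hγ hδ hη hC,
    integral_withDensity_eq_integral_toReal_smul₀
      ((integrableOn_reducedLikelihood C β hr hη).div_const _).aemeasurable.ennreal_ofReal
      (ae_of_all _ fun _ => ENNReal.ofReal_lt_top),
    ← intervalIntegral.integral_add (intervalIntegrable_pow_mul_partA C β hr hη k)
      (intervalIntegrable_pow_mul_partB C β hr hη k),
    ← intervalIntegral.integral_const_mul,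
    ← setIntegral_Ioo_eq_intervalIntegral _ (by norm_num)]
  refine integral_congr_ae ((posteriorDensity_nonneg_ae β hy hγ hδ hη hC).mono fun ρ hρ => ?_)
  rw [Pi.zero_apply] at hρ
  beta_reduce at hρ ⊢
  rw [ENNReal.toReal_ofReal hρ, smul_eq_mul, reducedLikelihood]
  ring

theorem posteriorMoment_of_even {k : ℕ} (hk : Even k) :
    posteriorMoment y C α β γ δ k = 1 / normConst y.n y.r C α β γ δ *
      ∫ ρ in (-1 : ℝ)..1, ρ ^ k * partA y.n y.r γ δ ρ * priorRho C α β ρ := by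
  rw [posteriorMoment_eq β hy hγ hδ hη hC k, integral_pow_mul_partB_of_even _ _ _ _ _ _ _ hk,
    add_zero]

theorem posteriorMoment_of_odd {k : ℕ} (hk : Odd k) :
    posteriorMoment y C α β γ δ k = 1 / normConst y.n y.r C α β γ δ *
      ∫ ρ in (-1 : ℝ)..1, ρ ^ k * partB y.n y.r γ δ ρ * priorRho C α β ρ := by
  rw [posteriorMoment_eq β hy hγ hδ hη hC k, integral_pow_mul_partA_of_odd _ _ _ _ _ _ _ hk,
    zero_add]

theorem posteriorMoment_eq_tsum_of_even {k : ℕ} (hk : Even k) :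
    posteriorMoment y C α β γ δ k = 1 / (C * normConst y.n y.r C α β γ δ) *
      ∑' m : ℕ, evenCoeff y.n α β γ δ k m * y.r ^ (2 * m) := by
  rw [posteriorMoment_of_even β hy hγ hδ hη hC hk,
    (hasSum_evenCoeff β hy.abs_r_lt_one hη hC.ne' hk).tsum_eq]
  field_simp

theorem posteriorMoment_eq_tsum_of_odd {k : ℕ} (hk : Odd k) :
    posteriorMoment y C α β γ δ k = 2 * ratioW y.n γ δ / (C * normConst y.n y.r C α β γ δ) *
      ∑' m : ℕ, oddCoeff y.n α β γ δ k m * y.r ^ (2 * m + 1) := by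
  have hW := ratioW_pos hγ hδ
  rw [posteriorMoment_of_odd β hy hγ hδ hη hC hk,
    (hasSum_oddCoeff β hy.abs_r_lt_one hγ hδ hη hC.ne' hk).tsum_eq]
  field_simp

end FullModel

end Posterior

end CorrPosterior

open CorrPosterior in
/-- Characterization of the marginal posteriors of `ρ`. The scaling constant `C > 0` of the prior on
`ρ` is arbitrary: `C = C_{α,β}` gives the normalized prior when `α > 0`, and `C = 1` the
unnormalized one for every real `α`. -/
theorem mainTheorem2 (y : Summary) (α β γ δ C : ℝ)
    (hn : 0 < y.n) (hs1 : 0 < y.s1) (hs2 : 0 < y.s2) (hr : |y.r| < 1)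
    (hγ : γ + 1 < (y.n : ℝ)) (hδ : δ + 1 < (y.n : ℝ))
    (hη : γ + δ - 2 * α + 1 < (y.n : ℝ)) (hC : 0 < C) :
    -- `C_{α,β}` is the normalization constant of the prior on `ρ`, if that prior is proper
    (0 < α → 0 < priorConst α β ∧ ∫ ρ in (-1 : ℝ)..1, priorRho (priorConst α β) α β ρ = 1) ∧
    -- factorization of the marginal likelihood
    (IntegrableOn (joint y C α β γ δ) paramSet ∧
      IntegrableOn (fun θ₀ => likelihood y θ₀ 0 * priorNuisance γ δ θ₀) nuisanceSet ∧
      nullMarginalLikelihood y γ δ =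
        2 ^ ((-γ - δ - 4) / 2) * (Real.pi ^ (1 - (y.n : ℝ)) / y.n) *
          (y.n * y.s1 ^ 2) ^ ((1 + γ - y.n) / 2) * (y.n * y.s2 ^ 2) ^ ((1 + δ - y.n) / 2) *
          Real.Gamma ((y.n - γ - 1) / 2) * Real.Gamma ((y.n - δ - 1) / 2) ∧
      marginalLikelihood y C α β γ δ =
        nullMarginalLikelihood y γ δ * normConst y.n y.r C α β γ δ) ∧
    -- the normalizing constant involves only the even part
    (0 < normConst y.n y.r C α β γ δ ∧
      IntervalIntegrable (fun ρ => partA y.n y.r γ δ ρ * priorRho C α β ρ) volume (-1) 1 ∧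
      IntervalIntegrable (fun ρ => partB y.n y.r γ δ ρ * priorRho C α β ρ) volume (-1) 1 ∧
      normConst y.n y.r C α β γ δ =
        ∫ ρ in (-1 : ℝ)..1, partA y.n y.r γ δ ρ * priorRho C α β ρ ∧
      ∫ ρ in (-1 : ℝ)..1, partB y.n y.r γ δ ρ * priorRho C α β ρ = 0) ∧
    -- it is the normalizing constant of the marginal posterior of `ρ`
    (IsProbabilityMeasure (marginalPosterior y C α β γ δ) ∧
      marginalPosterior y C α β γ δ =
        (volume.restrict (Set.Ioo (-1) 1)).withDensity (fun ρ => ENNReal.ofReal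
          (reducedLikelihood y.n y.r γ δ ρ * priorRho C α β ρ / normConst y.n y.r C α β γ δ))) ∧
    -- the posterior moments, as integrals and as series
    (∀ k : ℕ, Integrable (fun ρ : ℝ => ρ ^ k) (marginalPosterior y C α β γ δ) ∧
      (Even k →
        posteriorMoment y C α β γ δ k = 1 / normConst y.n y.r C α β γ δ *
          ∫ ρ in (-1 : ℝ)..1, ρ ^ k * partA y.n y.r γ δ ρ * priorRho C α β ρ) ∧
      (Odd k →
        posteriorMoment y C α β γ δ k = 1 / normConst y.n y.r C α β γ δ *
          ∫ ρ in (-1 : ℝ)..1, ρ ^ k * partB y.n y.r γ δ ρ * priorRho C α β ρ) ∧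
      (Even k →
        Summable (fun m : ℕ => evenCoeff y.n α β γ δ k m * y.r ^ (2 * m)) ∧
        posteriorMoment y C α β γ δ k = 1 / (C * normConst y.n y.r C α β γ δ) *
          ∑' m : ℕ, evenCoeff y.n α β γ δ k m * y.r ^ (2 * m)) ∧
      (Odd k →
        Summable (fun m : ℕ => oddCoeff y.n α β γ δ k m * y.r ^ (2 * m + 1)) ∧
        posteriorMoment y C α β γ δ k =
          2 * ratioW y.n γ δ / (C * normConst y.n y.r C α β γ δ) *
            ∑' m : ℕ, oddCoeff y.n α β γ δ k m * y.r ^ (2 * m + 1))) ∧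
    -- the series are hypergeometric when `β / 2` is a non-negative integer
    ((∃ j : ℕ, β = 2 * j) → ∀ k : ℕ,
      (Even k → IsHypergeometricSeq (evenCoeff y.n α β γ δ k)) ∧
      (Odd k → IsHypergeometricSeq (oddCoeff y.n α β γ δ k))) := by
  have hy : y.IsValid := ⟨hn, hs1, hs2, hr⟩
  have hnull := nullMarginalLikelihood_eq hy hγ hδ
  have hfull := marginalLikelihood_eq β hy hγ hδ hη hC
  have hpow := integrable_pow_marginalPosterior β hy hγ hδ hη hC
  refine ⟨fun hα => ⟨priorConst_pos β hα, integral_priorRho_priorConst β hα⟩,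
    ⟨integrableOn_joint β hy hγ hδ hη hC,
      integrableOn_likelihood_zero_mul_priorNuisance hy hγ hδ, hnull, hnull ▸ hfull⟩,
    ⟨normConst_pos β hr hγ hδ hη hC, intervalIntegrable_partA C β hr hη,
      intervalIntegrable_partB C β hr hη, normConst_eq_integral_partA C β hr hη,
      integral_partB y.n y.r C α β γ δ⟩,
    ⟨isProbabilityMeasure_marginalPosterior β hy hγ hδ hη hC,
      marginalPosterior_eq_withDensity β hy hγ hδ hη hC⟩,
    fun k => ⟨hpow k, posteriorMoment_of_even β hy hγ hδ hη hC,
      posteriorMoment_of_odd β hy hγ hδ hη hC,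
      fun hk => ⟨(hasSum_evenCoeff β hr hη hC.ne' hk).summable,
        posteriorMoment_eq_tsum_of_even β hy hγ hδ hη hC hk⟩,
      fun hk => ⟨(hasSum_oddCoeff β hr hγ hδ hη hC.ne' hk).summable,
        posteriorMoment_eq_tsum_of_odd β hy hγ hδ hη hC hk⟩⟩, ?_⟩
  rintro ⟨j, rfl⟩ k
  exact ⟨fun _ => isHypergeometricSeq_evenCoeff hη j k,
    fun _ => isHypergeometricSeq_oddCoeff hη j k⟩
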